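/- Let $m,d,e,k$ be positive integers with $e=\gcd(m,d)=\gcd(m,2d)$ and $2\le k\le \frac{m+e}{2e}$. Let $s$ be a maximum-length binary sequence of length $2^m-1$, i.e. a nonzero sequence $(s_t)_{t\in\mathbb Z/(2^m-1)}$ over $\mathbb F_2$ that satisfies a linear recurrence of order $m$ over $\mathbb F_2$ and has least period $2^m-1$. For $1\le j\le k-1$ let $s_j=(s_{f_jt})_{t}$ be the circular decimation of $s$ with factor $f_j$, where either $f_j=2^{jd}+1$ for all $j$, or $f_j=2^{(2j-1)d}+1$ for all $j$, or $f_j=2^{(\frac{m+e}{2e}-j)d}+1$ for all $j$. Let $C$ be the $\mathbb F_2$-vector space generated by all circular shifts of $s,s_1,\dots,s_{k-1}$. For $c=(c_0,\dots,c_{2^m-2})\in C$ put $\mathrm{DC}(c)=\sum_{t=0}^{2^m-2}(-1)^{c_t}$, and for $\varepsilon=\pm1$ and even $r$ with $0\le r\le\frac{m-e}{e}$ put \[\alpha_{r,\varepsilon}=\#\{0\ne c\in C\mid \mathrm{DC}(c)=-1+\varepsilon 2^{m-\frac{er}{2}}\}.\] Then for each $i=0,1,\dots,k-2$ and each $\varepsilon=\pm1$,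 \[\alpha_{\frac{m-e}{e}-2i,\varepsilon}=\frac12\left(2^{m-e-2ei}+\varepsilon 2^{\frac{m-e}{2}-ei}\right)\sum_{j=i}^{k-2}(-1)^{j-i}4^{e\binom{j-i}{2}}\binom{j}{i}_{4^e}\binom{\frac{m-e}{2e}}{j}_{4^e}\left(2^{m(k-1-j)}-1\right),\] where $\binom{a}{b}_q=\prod_{h=0}^{b-1}\frac{q^a-q^h}{q^b-q^h}$ is the Gaussian binomial coefficient. (Here $\alpha_{\frac{m-e}{e}-2i,\varepsilon}$ counts the nonzero codewords with DC component $-1+\varepsilon2^{\frac{m+e}{2}+ei}$.) -/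

import Mathlib

namespace GoldType

/-- Binary sequences of length `n`, indexed cyclically. -/
abbrev BinSeq (n : ℕ) : Type := ZMod n → ZMod 2

/-- The circular shift of a sequence by `u` places. -/
def shift {n : ℕ} (u : ZMod n) (s : BinSeq n) : BinSeq n := fun t => s (t + u)

/-- The circular decimation of a sequence with decimation factor `f`. -/
def decimate {n : ℕ} (f : ℕ) (s : BinSeq n) : BinSeq n := fun t => s ((f : ZMod n) * t)

/-- A maximum-length binary sequence of length `2 ^ m - 1`: a nonzero sequence produced by a linear
feedback shift register with `m` cells whose least period is `2 ^ m - 1`. -/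
def IsMaximumLength (m : ℕ) (s : BinSeq (2 ^ m - 1)) : Prop :=
  s ≠ 0 ∧
  (∃ a : Fin m → ZMod 2, ∀ t : ZMod (2 ^ m - 1),
    s (t + (m : ZMod (2 ^ m - 1))) = ∑ l : Fin m, a l * s (t + ((l : ℕ) : ZMod (2 ^ m - 1)))) ∧
  ∀ u : ZMod (2 ^ m - 1), shift u s = s → u = 0

/-- The three families of decimation factors. -/
inductive Family : Type
  | consecutive
  | odd
  | descending

/-- The multiple of `d` in the exponent of the `j`-th decimation factor (`1 ≤ j ≤ k - 1`). -/
def Family.multiplier (m e : ℕ) : Family → ℕ → ℕ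
  | .consecutive, j => j
  | .odd, j => 2 * j - 1
  | .descending, j => (m + e) / (2 * e) - j

/-- The `j`-th decimation factor. -/
def Family.factor (F : Family) (m d e j : ℕ) : ℕ := 2 ^ (F.multiplier m e j * d) + 1

/-- The Gold type code: the `𝔽₂`-span of all circular shifts of `s, s₁, …, s_{k-1}`, where `s_j` is
the decimation of `s` by the `j`-th factor of the family. -/
def code (F : Family) (m d e k : ℕ) (s : BinSeq (2 ^ m - 1)) :
    Submodule (ZMod 2) (BinSeq (2 ^ m - 1)) :=
  Submodule.span (ZMod 2)
    {c | ∃ u : ZMod (2 ^ m - 1), c = shift u s ∨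
      ∃ j ∈ Finset.Icc 1 (k - 1), c = shift u (decimate (F.factor m d e j) s)}

/-- The DC component of a binary sequence of length `n`. -/
def DC {n : ℕ} (c : BinSeq n) : ℤ :=
  ∑ t ∈ Finset.range n, (-1 : ℤ) ^ (c (t : ZMod n)).val

/-- The number of nonzero codewords of `C` with DC component `-1 + ε 2 ^ (m - e r / 2)`, for even
`r`. -/
noncomputable def dcFrequency (m e : ℕ) (C : Submodule (ZMod 2) (BinSeq (2 ^ m - 1)))
    (r : ℕ) (ε : ℤ) : ℕ :=
  Set.ncard {c : BinSeq (2 ^ m - 1) | c ∈ C ∧ c ≠ 0 ∧ DC c = -1 + ε * 2 ^ (m - e * r / 2)}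

/-- The Gaussian binomial coefficient (`q ≠ 0` not a root of unity). -/
def gaussBinom (q : ℚ) (a b : ℕ) : ℚ :=
  ∏ h ∈ Finset.range b, (q ^ a - q ^ h) / (q ^ b - q ^ h)

end GoldType

/-! Write `s t = Tr (b * γ ^ t)` with `γ` primitive in a field `L` of `2 ^ m` elements. The code
then consists of the words `Tr (a₀ x + ∑ a_j x ρ_j(x))`, `x = γ ^ t`, with `ρ_j` powers of Frobenius
(`code_eq_range_word`), and the DC component is `-1` plus an exponential sum over `L`. Let `K` be
the fixed field of the relevant power of Frobenius, `q = |K| = 2 ^ e`, `[L : K] = 2h + 1` and `κ = k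
- 1`.

The quadratic part `a` has polar form `Tr (N_a(x) y)`. Its exponential sums, twisted by the linear
part `a₀`, have square `0` or `|L| |ker N_a|`, and their first two moments over `a₀` fix how often
each value occurs (`two_mul_card_expSum_eq`). What remains is to count the `a ≠ 0` with `dim_K ker
N_a = 2i + 1`; the dimension is odd because alternating forms have even rank.

This count rests on two properties collected in `IsGoldSystem`. The `ρ_j` and their inverses lie in
a short cyclic interval of powers of a generator `τ`, so a nonzero `N_a` has kernel of dimension at
most `2κ` (`finrank_ker_skewPoly_le`). The remaining nontrivial automorphisms also lie in a short
interval, so nonzero operators supported there have rank above `2κ`. By trace duality it follows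
that for `r ≤ κ` the number of `a` whose kernel contains `r` given independent vectors depends only
on `r` (`IsGoldSystem.finrank_ker_evalPolar`).

Double counting turns this into the averages of `∏_{l<r} (|ker N_a| - q ^ l)`. A change of
polynomial basis (`sum_prod_sub_odd_pow`) rewrites them as averages of Gaussian binomials with base
`q ^ 2 = 4 ^ e`. Removing the term `a = 0` leaves a triangular system in `κ` unknowns, solved by
`gaussBinom_inversion`. -/

namespace GoldType

/-! ### Gaussian binomial coefficients -/

section Gauss

variable {Q : ℚ}

theorem pow_sub_pow_ne_zero (hQ : 1 < Q) {a b : ℕ} (h : a ≠ b) : Q ^ a - Q ^ b ≠ 0 := by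
  rw [sub_ne_zero]
  exact fun H => h (pow_right_injective₀ (by linarith) hQ.ne' H)

theorem pow_succ_sub_one_ne_zero (hQ : 1 < Q) (a : ℕ) : Q ^ (a + 1) - 1 ≠ 0 := by
  simpa using pow_sub_pow_ne_zero hQ (Nat.succ_ne_zero a)

@[simp] theorem gaussBinom_zero_right (a : ℕ) : gaussBinom Q a 0 = 1 := by
  simp [gaussBinom]

theorem gaussBinom_eq_zero_of_lt {a b : ℕ} (h : a < b) : gaussBinom Q a b = 0 :=
  Finset.prod_eq_zero (Finset.mem_range.2 h) (by simp)

theorem gaussBinom_eq_div (a b : ℕ) :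
    gaussBinom Q a b =
      (∏ h ∈ Finset.range b, (Q ^ a - Q ^ h)) / ∏ h ∈ Finset.range b, (Q ^ b - Q ^ h) :=
  Finset.prod_div_distrib _ _

theorem prod_pow_self_sub_pow_ne_zero (hQ : 1 < Q) (b : ℕ) :
    ∏ h ∈ Finset.range b, (Q ^ b - Q ^ h) ≠ 0 :=
  Finset.prod_ne_zero_iff.2 fun _ hh =>
    pow_sub_pow_ne_zero hQ (Finset.mem_range.1 hh).ne'

theorem gaussBinom_self (hQ : 1 < Q) (a : ℕ) : gaussBinom Q a a = 1 := by
  rw [gaussBinom_eq_div, div_self (prod_pow_self_sub_pow_ne_zero hQ a)]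

theorem gaussBinom_succ_succ_mul (hQ : 1 < Q) (a b : ℕ) :
    gaussBinom Q (a + 1) (b + 1) * (Q ^ (b + 1) - 1) = (Q ^ (a + 1) - 1) * gaussBinom Q a b := by
  have hQ0 : Q ≠ 0 := by linarith
  have h1 := pow_succ_sub_one_ne_zero hQ b
  have h2 : ∀ h : ℕ, (Q ^ (a + 1) - Q ^ (h + 1)) / (Q ^ (b + 1) - Q ^ (h + 1)) =
      (Q ^ a - Q ^ h) / (Q ^ b - Q ^ h) := fun h => by
    rw [pow_succ, pow_succ, pow_succ, ← sub_mul, ← sub_mul, mul_div_mul_right _ _ hQ0]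
  rw [gaussBinom, gaussBinom, Finset.prod_range_succ', Finset.prod_congr rfl fun h _ => h2 h,
    pow_zero, mul_assoc, div_mul_cancel₀ _ h1, mul_comm]

theorem gaussBinom_succ_right_mul (hQ : 1 < Q) (a b : ℕ) :
    gaussBinom Q a (b + 1) * (Q ^ b * (Q ^ (b + 1) - 1)) =
      gaussBinom Q a b * (Q ^ a - Q ^ b) := by
  have hQ0 : Q ≠ 0 := by linarith
  have h1 := pow_succ_sub_one_ne_zero hQ b
  have hd := prod_pow_self_sub_pow_ne_zero hQ b
  have h2 : ∏ h ∈ Finset.range (b + 1), (Q ^ (b + 1) - Q ^ h) =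
      (∏ h ∈ Finset.range b, (Q ^ b - Q ^ h)) * (Q ^ b * (Q ^ (b + 1) - 1)) := by
    rw [Finset.prod_range_succ', ← mul_assoc]
    have : ∀ h : ℕ, Q ^ (b + 1) - Q ^ (h + 1) = (Q ^ b - Q ^ h) * Q := fun h => by ring
    rw [Finset.prod_congr rfl fun h _ => this h, Finset.prod_mul_distrib]
    simp
  rw [gaussBinom_eq_div, gaussBinom_eq_div, h2, Finset.prod_range_succ]
  have : Q ^ b ≠ 0 := pow_ne_zero _ hQ0
  field_simp

theorem gaussBinom_pascal (hQ : 1 < Q) (a b : ℕ) :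
    gaussBinom Q (a + 1) (b + 1) = gaussBinom Q a b + Q ^ (b + 1) * gaussBinom Q a (b + 1) := by
  have h1 := pow_succ_sub_one_ne_zero hQ b
  have h2 := gaussBinom_succ_succ_mul hQ a b
  have h3 := gaussBinom_succ_right_mul hQ a b
  apply mul_right_cancel₀ h1
  rw [h2, add_mul]
  linear_combination (-Q) * h3

/-- The q-analogue of choosing a subset of a subset. It pulls a factor independent of `l` out of the
orthogonality sum. -/
theorem gaussBinom_mul_gaussBinom (hQ : 1 < Q) (i y l : ℕ) :
    gaussBinom Q (i + y) (i + l) * gaussBinom Q (i + l) i =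
      gaussBinom Q (i + y) i * gaussBinom Q y l := by
  induction i with
  | zero => simp
  | succ i ih =>
    have h1 := pow_succ_sub_one_ne_zero hQ (i + l)
    have h2 := pow_succ_sub_one_ne_zero hQ i
    have e1 := gaussBinom_succ_succ_mul hQ (i + y) (i + l)
    have e2 := gaussBinom_succ_succ_mul hQ (i + l) i
    have e3 := gaussBinom_succ_succ_mul hQ (i + y) i
    rw [show i + 1 + y = i + y + 1 by ring, show i + 1 + l = i + l + 1 by ring]
    apply mul_right_cancel₀ (mul_ne_zero h1 h2)
    calc _ = (gaussBinom Q (i + y + 1) (i + l + 1) * (Q ^ (i + l + 1) - 1)) *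
          (gaussBinom Q (i + l + 1) (i + 1) * (Q ^ (i + 1) - 1)) := by ring
      _ = (gaussBinom Q (i + y) (i + l) * gaussBinom Q (i + l) i) *
          ((Q ^ (i + y + 1) - 1) * (Q ^ (i + l + 1) - 1)) := by rw [e1, e2]; ring
      _ = (gaussBinom Q (i + y + 1) (i + 1) * (Q ^ (i + 1) - 1)) *
          gaussBinom Q y l * (Q ^ (i + l + 1) - 1) := by rw [ih, e3]; ring
      _ = _ := by ring

/-- Partial sums telescope by Pascal's rule; the complete sum vanishes because the last Gaussian
binomial does. -/
theorem sum_neg_one_pow_mul_gaussBinom_succ (hQ : 1 < Q) (y t : ℕ) :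
    ∑ l ∈ Finset.range (t + 1), (-1) ^ l * Q ^ l.choose 2 * gaussBinom Q (y + 1) l =
      (-1) ^ t * Q ^ (t + 1).choose 2 * gaussBinom Q y t := by
  induction t with
  | zero => simp
  | succ t ih =>
    rw [Finset.sum_range_succ, ih, gaussBinom_pascal hQ,
      show (t + 1 + 1).choose 2 = (t + 1) + (t + 1).choose 2 by
        rw [Nat.choose_succ_succ' (t + 1) 1, Nat.choose_one_right]]
    ring

theorem sum_neg_one_pow_mul_gaussBinom (hQ : 1 < Q) {y t : ℕ} (h : y ≤ t) :
    ∑ l ∈ Finset.range (t + 1), (-1) ^ l * Q ^ l.choose 2 * gaussBinom Q y l =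
      if y = 0 then 1 else 0 := by
  rcases y with _ | y
  · rw [Finset.sum_range_succ', Finset.sum_eq_zero fun l _ => by
      rw [gaussBinom_eq_zero_of_lt l.succ_pos, mul_zero]]
    simp
  · rw [sum_neg_one_pow_mul_gaussBinom_succ hQ, gaussBinom_eq_zero_of_lt (by omega)]
    simp

theorem sum_gaussBinom_mul_gaussBinom (hQ : 1 < Q) {i x M : ℕ} (hi : i ≤ M) (hx : x ≤ M) :
    ∑ j ∈ Finset.Icc i M,
      (-1) ^ (j - i) * Q ^ (j - i).choose 2 * gaussBinom Q j i * gaussBinom Q x j =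
        if x = i then 1 else 0 := by
  rcases lt_or_ge x i with h | h
  · rw [if_neg h.ne, Finset.sum_eq_zero]
    intro j hj
    rw [gaussBinom_eq_zero_of_lt (h.trans_le (Finset.mem_Icc.1 hj).1), mul_zero]
  · obtain ⟨y, rfl⟩ := Nat.exists_eq_add_of_le h
    obtain ⟨t, rfl⟩ := Nat.exists_eq_add_of_le hi
    have key : ∀ l ∈ Finset.range (t + 1),
        (-1) ^ (i + l - i) * Q ^ (i + l - i).choose 2 * gaussBinom Q (i + l) i *
          gaussBinom Q (i + y) (i + l) =
        gaussBinom Q (i + y) i * ((-1) ^ l * Q ^ l.choose 2 * gaussBinom Q y l) := by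
      intro l _
      rw [Nat.add_sub_cancel_left, mul_assoc _ (gaussBinom Q (i + l) i),
        mul_comm (gaussBinom Q (i + l) i), gaussBinom_mul_gaussBinom hQ]
      ring
    rw [← Finset.Ico_add_one_right_eq_Icc, Finset.sum_Ico_eq_sum_range,
      show i + t + 1 - i = t + 1 by omega, Finset.sum_congr rfl key, ← Finset.mul_sum,
      sum_neg_one_pow_mul_gaussBinom hQ (by omega)]
    rcases y with _ | y
    · simp [gaussBinom_self hQ]
    · simp

/-- Inversion of a triangular system given by Gaussian binomial coefficients. -/
theorem gaussBinom_inversion (hQ : 1 < Q) {M : ℕ} {A c : ℕ → ℚ}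
    (h : ∀ j ≤ M, ∑ x ∈ Finset.range (M + 1), A x * gaussBinom Q x j = c j) {i : ℕ} (hi : i ≤ M) :
    A i = ∑ j ∈ Finset.Icc i M,
      (-1) ^ (j - i) * Q ^ (j - i).choose 2 * gaussBinom Q j i * c j := by
  have : ∀ j ∈ Finset.Icc i M,
      (-1) ^ (j - i) * Q ^ (j - i).choose 2 * gaussBinom Q j i * c j =
      ∑ x ∈ Finset.range (M + 1), A x *
        ((-1) ^ (j - i) * Q ^ (j - i).choose 2 * gaussBinom Q j i * gaussBinom Q x j) := by
    intro j hj
    rw [← h j (Finset.mem_Icc.1 hj).2, Finset.mul_sum]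
    exact Finset.sum_congr rfl fun x _ => by ring
  rw [Finset.sum_congr rfl this, Finset.sum_comm]
  simp_rw [← Finset.mul_sum]
  rw [Finset.sum_congr rfl fun x hx => by
    rw [sum_gaussBinom_mul_gaussBinom hQ hi (Nat.lt_succ_iff.1 (Finset.mem_range.1 hx))]]
  simp [hi]

end Gauss

/-! ### Comparing two bases of polynomials -/

section Moments

/-- The coefficients of `∏_{l < u} (Z - q ^ l)` in the basis `∏_{l < j} (Z - q ^ (2 * l + 1))`. -/
def oddCoeff (q : ℚ) : ℕ → ℕ → ℚ
  | 0, 0 => 1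
  | 0, _ + 1 => 0
  | u + 1, 0 => (q - q ^ u) * oddCoeff q u 0
  | u + 1, j + 1 => oddCoeff q u j + (q ^ (2 * (j + 1) + 1) - q ^ u) * oddCoeff q u (j + 1)

variable {q : ℚ}

theorem oddCoeff_eq_zero {u j : ℕ} (h : u < j) : oddCoeff q u j = 0 := by
  induction u generalizing j with
  | zero =>
    obtain ⟨j, rfl⟩ := Nat.exists_eq_succ_of_ne_zero h.ne'
    rfl
  | succ u ih =>
    obtain ⟨j, rfl⟩ := Nat.exists_eq_succ_of_ne_zero (by omega : j ≠ 0)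
    rw [Nat.succ_eq_add_one, oddCoeff, ih (by omega), ih (by omega)]
    simp

theorem oddCoeff_self (u : ℕ) : oddCoeff q u u = 1 := by
  induction u with
  | zero => rfl
  | succ u ih => rw [oddCoeff, ih, oddCoeff_eq_zero (by omega)]; simp

/-- The recursion comes from `Z - q ^ u = (Z - q ^ (2j+1)) + (q ^ (2j+1) - q ^ u)`. Leaving `F`
arbitrary lets it serve both the polynomial expansion and the evaluation in `sum_oddCoeff_mul_prod`.
-/
theorem sum_oddCoeff_succ (u : ℕ) (F : ℕ → ℚ) :
    ∑ j ∈ Finset.range (u + 2), oddCoeff q (u + 1) j * F j =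
      ∑ j ∈ Finset.range (u + 1),
        oddCoeff q u j * (F (j + 1) + (q ^ (2 * j + 1) - q ^ u) * F j) := by
  have h1 : ∑ j ∈ Finset.range (u + 1), oddCoeff q u j * ((q ^ (2 * j + 1) - q ^ u) * F j) =
      ∑ j ∈ Finset.range (u + 2), oddCoeff q u j * ((q ^ (2 * j + 1) - q ^ u) * F j) := by
    rw [Finset.sum_range_succ _ (u + 1), oddCoeff_eq_zero (Nat.lt_succ_self u)]
    simp
  simp_rw [mul_add]
  rw [Finset.sum_add_distrib, h1, Finset.sum_range_succ', Finset.sum_range_succ' _ (u + 1),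
    ← add_assoc, ← Finset.sum_add_distrib]
  congr 1
  · exact Finset.sum_congr rfl fun j _ => by rw [oddCoeff]; ring
  · rw [oddCoeff]; ring

theorem prod_sub_pow_eq_sum (Z : ℚ) (u : ℕ) :
    ∏ l ∈ Finset.range u, (Z - q ^ l) =
      ∑ j ∈ Finset.range (u + 1),
        oddCoeff q u j * ∏ l ∈ Finset.range j, (Z - q ^ (2 * l + 1)) := by
  induction u with
  | zero => simp [oddCoeff]
  | succ u ih =>
    rw [sum_oddCoeff_succ, Finset.prod_range_succ, ih, Finset.sum_mul]
    refine Finset.sum_congr rfl fun j _ => ?_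
    rw [Finset.prod_range_succ]
    ring

theorem one_sub_mul_prod_shift (w : ℚ) (j : ℕ) :
    (1 - q * w) * ∏ l ∈ Finset.range j, (1 - q ^ (2 * l + 1) * (q ^ 2 * w)) =
      (∏ l ∈ Finset.range j, (1 - q ^ (2 * l + 1) * w)) * (1 - q ^ (2 * j + 1) * w) := by
  rw [← Finset.prod_range_succ (fun l => 1 - q ^ (2 * l + 1) * w), Finset.prod_range_succ']
  rw [mul_comm]
  congr 1
  · exact Finset.prod_congr rfl fun l _ => by ring
  · ring

theorem one_sub_mul_prod_pow_shift (w : ℚ) (u : ℕ) :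
    (1 - w) * (1 - q * w) * ∏ l ∈ Finset.range u, (q ^ (l + 1) * (1 - q ^ l * (q ^ 2 * w))) =
      (∏ l ∈ Finset.range u, (q ^ (l + 1) * (1 - q ^ l * w))) *
        ((1 - q ^ u * w) * (1 - q ^ (u + 1) * w)) := by
  have h1 : (∏ l ∈ Finset.range u, (1 - q ^ l * w)) * (1 - q ^ u * w) * (1 - q ^ (u + 1) * w) =
      (∏ l ∈ Finset.range u, (1 - q ^ l * (q ^ 2 * w))) * (1 - q * w) * (1 - w) := by
    rw [← Finset.prod_range_succ (fun l => 1 - q ^ l * w),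
      ← Finset.prod_range_succ (fun l => 1 - q ^ l * w), Finset.prod_range_succ',
      Finset.prod_range_succ', Finset.prod_congr rfl fun l _ =>
        show 1 - q ^ (l + 1 + 1) * w = 1 - q ^ l * (q ^ 2 * w) by ring]
    ring
  rw [Finset.prod_mul_distrib, Finset.prod_mul_distrib]
  linear_combination -(∏ l ∈ Finset.range u, q ^ (l + 1)) * h1

/-- After multiplication by `w`, the factor depending on `j` becomes `(1 - q ^ u w) - (1 - w)(1 - q
^ (2j+1) w)`, and `1 - q ^ (2j+1) w` is absorbed by passing from `w` to `q ^ 2 w`. Hence the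
induction uses the hypothesis at both `w` and `q ^ 2 * w`. -/
theorem sum_oddCoeff_mul_prod (u : ℕ) {w : ℚ} (hq : q ≠ 0) (hw : w ≠ 0) :
    ∑ j ∈ Finset.range (u + 1),
      oddCoeff q u j * ∏ l ∈ Finset.range j, (1 - q ^ (2 * l + 1) * w) =
    ∏ l ∈ Finset.range u, (q ^ (l + 1) * (1 - q ^ l * w)) := by
  induction u generalizing w with
  | zero => simp [oddCoeff]
  | succ u ih =>
    have h1 := ih hw
    have h2 := ih (mul_ne_zero (pow_ne_zero 2 hq) hw)
    have hs := one_sub_mul_prod_pow_shift (q := q) w u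
    rw [← h2] at hs
    rw [sum_oddCoeff_succ, Finset.prod_range_succ]
    apply mul_left_cancel₀ hw
    have key : ∀ j ∈ Finset.range (u + 1),
        w * (oddCoeff q u j * (∏ l ∈ Finset.range (j + 1), (1 - q ^ (2 * l + 1) * w) +
          (q ^ (2 * j + 1) - q ^ u) * ∏ l ∈ Finset.range j, (1 - q ^ (2 * l + 1) * w))) =
        (1 - q ^ u * w) * (oddCoeff q u j * ∏ l ∈ Finset.range j, (1 - q ^ (2 * l + 1) * w)) -
        (1 - w) * (1 - q * w) * (oddCoeff q u j *
          ∏ l ∈ Finset.range j, (1 - q ^ (2 * l + 1) * (q ^ 2 * w))) := by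
      intro j _
      have := one_sub_mul_prod_shift (q := q) w j
      rw [Finset.prod_range_succ]
      linear_combination oddCoeff q u j * (1 - w) * this
    rw [Finset.mul_sum, Finset.sum_congr rfl key, Finset.sum_sub_distrib, ← Finset.mul_sum,
      ← Finset.mul_sum, hs, h1]
    ring

/-- If the averages of `∏_{l < r} (Z - q ^ l)` are those of the radical size of a random alternating
form, then so are the averages of `∏_{l < j} (Z - q ^ (2 * l + 1))`. -/
theorem sum_prod_sub_odd_pow {α : Type*} (s : Finset α) (Z : α → ℚ) {N w : ℚ} {κ : ℕ} (hq : q ≠ 0)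
    (hw : w ≠ 0)
    (h : ∀ r ≤ κ, ∑ a ∈ s, ∏ l ∈ Finset.range r, (Z a - q ^ l) =
      N * ∏ l ∈ Finset.range r, (q ^ (l + 1) * (1 - q ^ l * w))) {j : ℕ} (hj : j ≤ κ) :
    ∑ a ∈ s, ∏ l ∈ Finset.range j, (Z a - q ^ (2 * l + 1)) =
      N * ∏ l ∈ Finset.range j, (1 - q ^ (2 * l + 1) * w) := by
  induction j using Nat.strong_induction_on with
  | _ j ih =>
    have h1 := h j hj
    simp_rw [prod_sub_pow_eq_sum] at h1
    rw [← sum_oddCoeff_mul_prod j hq hw, Finset.sum_comm] at h1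
    simp_rw [← Finset.mul_sum] at h1
    -- The change of basis is unitriangular, so the terms below `j` cancel by induction and the top
    -- ones must agree.
    rw [Finset.sum_range_succ, Finset.sum_range_succ, oddCoeff_self, one_mul, one_mul, mul_add,
      Finset.mul_sum, Finset.sum_congr rfl fun i hi => by
        rw [ih i (Finset.mem_range.1 hi) ((Finset.mem_range.1 hi).le.trans hj)],
      Finset.sum_congr rfl fun i _ => mul_left_comm _ N _] at h1
    exact add_left_cancel h1

/-- The averages in terms of Gaussian binomial coefficients with base `q ^ 2`. -/
theorem sum_gaussBinom_sq {α : Type*} (s : Finset α) (x : α → ℕ) {h κ : ℕ} (hq : 1 < q)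
    (H : ∀ r ≤ κ, ∑ a ∈ s, ∏ l ∈ Finset.range r, (q ^ (2 * x a + 1) - q ^ l) =
      q ^ ((2 * h + 1) * κ) *
        ∏ l ∈ Finset.range r, (q ^ (l + 1) * (1 - q ^ l * (q ^ (2 * h + 1))⁻¹))) {j : ℕ}
    (hj : j ≤ κ) :
    ∑ a ∈ s, gaussBinom (q ^ 2) (x a) j =
      q ^ ((2 * h + 1) * (κ - j)) * gaussBinom (q ^ 2) h j := by
  have hq0 : q ≠ 0 := by linarith
  have hQ : 1 < q ^ 2 := one_lt_pow₀ hq two_ne_zero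
  have h1 := sum_prod_sub_odd_pow s (fun a => q ^ (2 * x a + 1)) hq0
    (inv_ne_zero (pow_ne_zero _ hq0)) H hj
  -- Odd exponents on both sides of each difference leave a factor `q` and a difference of powers of
  -- `q ^ 2`: this is where the base `q ^ 2` enters.
  have h2 : ∀ a, ∏ l ∈ Finset.range j, (q ^ (2 * x a + 1) - q ^ (2 * l + 1)) =
      q ^ j * ∏ l ∈ Finset.range j, ((q ^ 2) ^ x a - (q ^ 2) ^ l) := by
    intro a
    rw [← Finset.card_range j, ← Finset.prod_const, Finset.card_range, ← Finset.prod_mul_distrib]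
    exact Finset.prod_congr rfl fun l _ => by rw [← pow_mul, ← pow_mul]; ring
  have h3 : q ^ ((2 * h + 1) * κ) *
      ∏ l ∈ Finset.range j, (1 - q ^ (2 * l + 1) * (q ^ (2 * h + 1))⁻¹) =
      q ^ j * (q ^ ((2 * h + 1) * (κ - j)) *
        ∏ l ∈ Finset.range j, ((q ^ 2) ^ h - (q ^ 2) ^ l)) := by
    have e : q ^ ((2 * h + 1) * κ) = q ^ ((2 * h + 1) * (κ - j)) * (q ^ (2 * h + 1)) ^ j := by
      rw [← pow_mul, ← pow_add, ← mul_add, Nat.sub_add_cancel hj]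
    rw [e, mul_assoc, mul_left_comm (q ^ j)]
    congr 1
    rw [← Finset.card_range j, ← Finset.prod_const, ← Finset.prod_const, Finset.card_range,
      ← Finset.prod_mul_distrib, ← Finset.prod_mul_distrib]
    refine Finset.prod_congr rfl fun l _ => ?_
    have : q ^ (2 * h + 1) ≠ 0 := pow_ne_zero _ hq0
    rw [← pow_mul, ← pow_mul, mul_sub, mul_one, mul_left_comm, mul_inv_cancel₀ this]
    ring
  simp_rw [h2] at h1
  rw [h3, ← Finset.mul_sum] at h1
  have h4 := mul_left_cancel₀ (pow_ne_zero j hq0) h1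
  simp_rw [gaussBinom_eq_div]
  rw [← Finset.sum_div, h4, mul_div_assoc]

end Moments

end GoldType

namespace GoldType

open Module

set_option linter.unusedSectionVars false

/-! ### Linear combinations of field automorphisms -/

theorem finrank_ker_comp_le {K V V' V'' : Type*} [Field K] [AddCommGroup V] [Module K V]
    [AddCommGroup V'] [Module K V'] [AddCommGroup V''] [Module K V''] [FiniteDimensional K V]
    [FiniteDimensional K V'] (f : V →ₗ[K] V') (g : V' →ₗ[K] V'') :
    finrank K (LinearMap.ker (g ∘ₗ f)) ≤ finrank K (LinearMap.ker f) +
      finrank K (LinearMap.ker g) := by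
  have h := (f.domRestrict (LinearMap.ker (g ∘ₗ f))).finrank_range_add_finrank_ker
  have h1 : finrank K (LinearMap.range (f.domRestrict (LinearMap.ker (g ∘ₗ f)))) ≤
      finrank K (LinearMap.ker g) := by
    apply Submodule.finrank_mono
    rintro _ ⟨x, rfl⟩
    exact x.2
  have h2 : finrank K (LinearMap.ker (f.domRestrict (LinearMap.ker (g ∘ₗ f)))) ≤
      finrank K (LinearMap.ker f) := by
    rw [← Submodule.finrank_map_subtype_eq]
    apply Submodule.finrank_mono
    rintro _ ⟨x, hx, rfl⟩
    exact hx
  omega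

variable {K L : Type*} [Field K] [Field L] [Algebra K L] [FiniteDimensional K L]

theorem mem_range_algebraMap_of_fixed [IsGalois K L] {τ : L ≃ₐ[K] L}
    (hτ : ∀ g, g ∈ Subgroup.zpowers τ) {x : L} (hx : τ x = x) : x ∈ (algebraMap K L).range := by
  have h : x ∈ (⊥ : IntermediateField K L) := by
    rw [IsGalois.mem_bot_iff_fixed]
    intro g
    have : Subgroup.zpowers τ ≤ MulAction.stabilizer (L ≃ₐ[K] L) x := by
      rw [Subgroup.zpowers_le]
      exact hx
    exact this (hτ g)
  exact h

/-- The additive polynomial `∑_{l < D} c_l τ ^ l`. -/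
def skewPoly (τ : L ≃ₐ[K] L) (c : ℕ → L) (D : ℕ) : L →ₗ[K] L :=
  ∑ l ∈ Finset.range D, LinearMap.mulLeft K (c l) ∘ₗ (τ ^ l).toLinearMap

theorem skewPoly_apply (τ : L ≃ₐ[K] L) (c : ℕ → L) (D : ℕ) (x : L) :
    skewPoly τ c D x = ∑ l ∈ Finset.range D, c l * (τ ^ l) x := by
  simp [skewPoly, LinearMap.sum_apply]

theorem sum_mul_eq_sum_partial_mul_sub {R : Type*} [CommRing R] (c z : ℕ → R) (D : ℕ) :
    ∑ l ∈ Finset.range (D + 1), c l * z l =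
      (∑ l ∈ Finset.range (D + 1), c l) * z D +
        ∑ l ∈ Finset.range D, (∑ i ∈ Finset.range (l + 1), c i) * (z l - z (l + 1)) := by
  induction D with
  | zero => simp
  | succ D ih =>
    rw [Finset.sum_range_succ, ih, Finset.sum_range_succ c (D + 1),
      Finset.sum_range_succ (fun l => (∑ i ∈ Finset.range (l + 1), c i) * (z l - z (l + 1))) D]
    ring

/-- A nonzero polynomial of degree at most `D` in a generator `τ` of the Galois group has at most
`D` linearly independent roots. -/
theorem finrank_ker_skewPoly_le {τ : L ≃ₐ[K] L}
    (hτ : ∀ x : L, τ x = x → x ∈ (algebraMap K L).range) (c : ℕ → L) (D : ℕ)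
    (hc : ∃ l ≤ D, c l ≠ 0) : finrank K (LinearMap.ker (skewPoly τ c (D + 1))) ≤ D := by
  induction D generalizing c with
  | zero =>
    obtain ⟨l, hl, h⟩ := hc
    obtain rfl : l = 0 := by omega
    rw [Nat.le_zero, Submodule.finrank_eq_zero, LinearMap.ker_eq_bot']
    intro x hx
    rw [skewPoly_apply] at hx
    simpa [h] using hx
  | succ D ih =>
    by_cases hbot : LinearMap.ker (skewPoly τ c (D + 1 + 1)) = ⊥
    · rw [hbot, finrank_bot]
      omega
    obtain ⟨z, hz, hz0⟩ := Submodule.exists_mem_ne_zero_of_ne_bot hbot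
    rw [LinearMap.mem_ker, skewPoly_apply] at hz
    set c' : ℕ → L := fun l => c l * (τ ^ l) z with hc'
    set b : ℕ → L := fun l => ∑ i ∈ Finset.range (l + 1), c' i with hb
    -- Substituting `x z` for `x` makes `1` a root. Abel summation then splits off `id - τ` on the
    -- right, which lowers the degree by one and has kernel of dimension at most one.
    have hcomp : skewPoly τ c (D + 1 + 1) ∘ₗ LinearMap.mulRight K z =
        skewPoly τ b (D + 1) ∘ₗ (LinearMap.id - τ.toLinearMap) := by
      ext x
      have h1 := sum_mul_eq_sum_partial_mul_sub c' (fun l => (τ ^ l) x) (D + 1)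
      rw [hz, zero_mul, zero_add] at h1
      simp only [LinearMap.comp_apply, skewPoly_apply, LinearMap.mulRight_apply, map_mul,
        LinearMap.sub_apply, LinearMap.id_apply, AlgEquiv.toLinearMap_apply]
      rw [Finset.sum_congr rfl fun l _ => show c l * ((τ ^ l) x * (τ ^ l) z) =
        c' l * (τ ^ l) x by rw [hc']; ring, h1]
      exact Finset.sum_congr rfl fun l _ => by rw [pow_succ, AlgEquiv.mul_apply, map_sub]
    have hbne : ∃ l ≤ D, b l ≠ 0 := by
      by_contra! h
      have hc0 : ∀ l ≤ D + 1, c' l = 0 := by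
        intro l hl
        have e : b l = 0 := by
          rcases hl.eq_or_lt with rfl | hl
          · exact hz
          · exact h l (by omega)
        rcases l with _ | l
        · simpa [hb] using e
        · have e' := h l (by omega)
          simp only [hb] at e e'
          rwa [Finset.sum_range_succ, e', zero_add] at e
      obtain ⟨l, hl, hcl⟩ := hc
      exact mul_ne_zero hcl ((map_ne_zero_iff _ (τ ^ l).injective).2 hz0) (hc0 l hl)
    have hker : finrank K (LinearMap.ker (LinearMap.id - τ.toLinearMap)) ≤ 1 := by
      refine le_trans (Submodule.finrank_mono (t := Submodule.span K {(1 : L)}) ?_)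
        (finrank_span_singleton one_ne_zero).le
      intro x hx
      have hx' : τ x = x := by
        exact (sub_eq_zero.1 (LinearMap.mem_ker.1 hx)).symm
      obtain ⟨y, rfl⟩ := hτ x hx'
      exact Submodule.mem_span_singleton.2 ⟨y, by rw [Algebra.smul_def, mul_one]⟩
    have heq : finrank K (LinearMap.ker (skewPoly τ c (D + 1 + 1))) =
        finrank K (LinearMap.ker (skewPoly τ c (D + 1 + 1) ∘ₗ LinearMap.mulRight K z)) := by
      have hs : Function.Surjective (LinearMap.mulRight K z) := fun y =>
        ⟨y * z⁻¹, by simp [hz0]⟩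
      have h1 := (skewPoly τ c (D + 1 + 1) ∘ₗ LinearMap.mulRight K z).finrank_range_add_finrank_ker
      have h2 := (skewPoly τ c (D + 1 + 1)).finrank_range_add_finrank_ker
      rw [LinearMap.range_comp_of_range_eq_top _ (LinearMap.range_eq_top.2 hs)] at h1
      omega
    rw [heq, hcomp]
    refine (finrank_ker_comp_le _ _).trans ?_
    have := ih b hbne
    omega

/-- The operator `x ↦ ∑_g C_g g(x)`. -/
noncomputable def galOp (C : (L ≃ₐ[K] L) → L) : L →ₗ[K] L :=
  ∑ g, LinearMap.mulLeft K (C g) ∘ₗ g.toLinearMap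

theorem galOp_apply (C : (L ≃ₐ[K] L) → L) (x : L) : galOp C x = ∑ g, C g * g x := by
  simp [galOp, LinearMap.sum_apply]

/-- Taking the bijection `β` out on the left leaves a polynomial in `τ` of degree at most `D`, so
only the length of the interval supporting `C` matters, not its position. -/
theorem finrank_ker_galOp_le {τ : L ≃ₐ[K] L}
    (hτ : ∀ x : L, τ x = x → x ∈ (algebraMap K L).range) {C : (L ≃ₐ[K] L) → L} (hC : C ≠ 0)
    (β : L ≃ₐ[K] L) {D : ℕ} (hD : D < orderOf τ) (hsupp : ∀ g, C g ≠ 0 → ∃ l ≤ D, g = β * τ ^ l) :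
    finrank K (LinearMap.ker (galOp C)) ≤ D := by
  classical
  have hcomp : galOp C = β.toLinearMap ∘ₗ skewPoly τ (fun l => β⁻¹ (C (β * τ ^ l))) (D + 1) := by
    ext x
    have hβ : ∀ y, β (β⁻¹ y) = y := fun y => by rw [← AlgEquiv.mul_apply, mul_inv_cancel]; rfl
    rw [LinearMap.comp_apply, galOp_apply, skewPoly_apply, AlgEquiv.toLinearMap_apply, map_sum]
    simp_rw [map_mul, hβ]
    have hinj : Set.InjOn (fun l => β * τ ^ l) (Finset.range (D + 1) : Set ℕ) := by
      intro i hi j hj hij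
      simp only [Finset.coe_range, Set.mem_Iio] at hi hj
      exact pow_injOn_Iio_orderOf (show i < _ by omega) (show j < _ by omega)
        (mul_left_cancel hij)
    rw [← Finset.sum_subset (Finset.subset_univ ((Finset.range (D + 1)).image fun l => β * τ ^ l)),
      Finset.sum_image hinj]
    · rfl
    · intro g _ hg
      by_contra h
      obtain ⟨l, hl, rfl⟩ := hsupp g (left_ne_zero_of_mul h)
      exact hg (Finset.mem_image_of_mem _ (Finset.mem_range.2 (by omega)))
  have hker : LinearMap.ker (galOp C) =
      LinearMap.ker (skewPoly τ (fun l => β⁻¹ (C (β * τ ^ l))) (D + 1)) := by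
    rw [hcomp]
    exact LinearMap.ker_comp_of_ker_eq_bot _ (LinearMap.ker_eq_bot.2 β.injective)
  rw [hker]
  apply finrank_ker_skewPoly_le hτ
  obtain ⟨g, hg⟩ := Function.ne_iff.1 hC
  obtain ⟨l, hl, rfl⟩ := hsupp g hg
  exact ⟨l, hl, (map_ne_zero_iff _ (β⁻¹).injective).2 hg⟩

/-! ### The polar forms -/

variable {ι : Type*} [Fintype ι]

/-- The operator `N` with `Tr(N(x) y)` the polarisation of the quadratic form
`Tr(∑_j a_j x ρ_j(x))`. -/
noncomputable def polarOp (ρ : ι → L ≃ₐ[K] L) (a : ι → L) : L →ₗ[K] L :=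
  ∑ j, (LinearMap.mulLeft K (a j) ∘ₗ (ρ j).toLinearMap +
    (ρ j)⁻¹.toLinearMap ∘ₗ LinearMap.mulLeft K (a j))

theorem polarOp_apply (ρ : ι → L ≃ₐ[K] L) (a : ι → L) (x : L) :
    polarOp ρ a x = ∑ j, (a j * ρ j x + (ρ j)⁻¹ (a j * x)) := by
  simp [polarOp, LinearMap.sum_apply]

/-- Systems of automorphisms such that operators supported on the `ρ_j` and their inverses, and
operators supported on the nontrivial remaining automorphisms, have small kernels. -/
structure IsGoldSystem (ρ : ι → L ≃ₐ[K] L) : Prop where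
  injective : Function.Injective ρ
  ne_inv : ∀ i j, ρ i ≠ (ρ j)⁻¹
  thin : ∀ C : (L ≃ₐ[K] L) → L, C ≠ 0 → (∀ g, C g ≠ 0 → ∃ j, g = ρ j ∨ g = (ρ j)⁻¹) →
    finrank K (LinearMap.ker (galOp C)) ≤ 2 * Fintype.card ι
  cothin : ∀ C : (L ≃ₐ[K] L) → L, C ≠ 0 → (∀ g, C g ≠ 0 → g ≠ 1 ∧ ∀ j, g ≠ ρ j ∧ g ≠ (ρ j)⁻¹) →
    finrank K (LinearMap.ker (galOp C)) + 2 * Fintype.card ι < finrank K L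

theorem IsGoldSystem.finrank_ker_polarOp_le {ρ : ι → L ≃ₐ[K] L} (hρ : IsGoldSystem ρ) {a : ι → L}
    (ha : a ≠ 0) : finrank K (LinearMap.ker (polarOp ρ a)) ≤ 2 * Fintype.card ι := by
  classical
  set C : (L ≃ₐ[K] L) → L := fun g => ∑ j, ((if g = ρ j then a j else 0) +
    (if g = (ρ j)⁻¹ then (ρ j)⁻¹ (a j) else 0)) with hC
  have hop : polarOp ρ a = galOp C := by
    ext x
    rw [polarOp_apply, galOp_apply]
    simp only [hC, Finset.sum_mul, add_mul, ite_mul, zero_mul]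
    rw [Finset.sum_comm]
    simp [Finset.sum_add_distrib]
  rw [hop]
  refine hρ.thin C ?_ ?_
  · obtain ⟨i, hi⟩ := Function.ne_iff.1 ha
    refine Function.ne_iff.2 ⟨ρ i, ?_⟩
    -- No other `ρ_j` and no inverse coincides with `ρ i`, so nothing can cancel `a i`.
    have : C (ρ i) = a i := by
      simp only [hC, Finset.sum_add_distrib]
      simp [hρ.ne_inv, hρ.injective.eq_iff]
    rwa [this]
  · intro g hg
    obtain ⟨j, -, hj⟩ := Finset.exists_ne_zero_of_sum_ne_zero hg
    refine ⟨j, ?_⟩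
    by_contra! h
    simp [h.1, h.2] at hj

/-- The trace form on families of field elements. -/
noncomputable def piTraceForm (K L ι : Type*) [Field K] [Field L] [Algebra K L] [Fintype ι] :
    LinearMap.BilinForm K (ι → L) :=
  ∑ i, (Algebra.traceForm K L).compl₁₂ (LinearMap.proj i) (LinearMap.proj i)

theorem piTraceForm_apply (v w : ι → L) :
    piTraceForm K L ι v w = ∑ i, Algebra.trace K L (v i * w i) := by
  simp [piTraceForm, LinearMap.sum_apply, Algebra.traceForm_apply]

theorem eq_zero_of_trace_mul_eq_zero [Algebra.IsSeparable K L] {x : L}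
    (h : ∀ y, Algebra.trace K L (x * y) = 0) : x = 0 :=
  (traceForm_nondegenerate K L).1 x h

theorem piTraceForm_nondegenerate [Algebra.IsSeparable K L] :
    (piTraceForm K L ι).Nondegenerate := by
  classical
  have hl : ∀ v : ι → L, (∀ w, piTraceForm K L ι v w = 0) → v = 0 := by
    intro v hv
    ext i
    refine eq_zero_of_trace_mul_eq_zero (K := K) fun y => ?_
    have := hv (Pi.single i y)
    rw [piTraceForm_apply, Finset.sum_eq_single i (fun j _ hj => by simp [hj]) (by simp)] at this
    simpa using this
  refine ⟨hl, fun w hw => hl w fun v => ?_⟩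
  rw [← hw v, piTraceForm_apply, piTraceForm_apply]
  simp_rw [mul_comm]

/-- The kernel of the adjoint is the orthogonal complement of the range. -/
theorem finrank_ker_add_finrank_of_adjoint {K E F : Type*} [Field K] [AddCommGroup E] [Module K E]
    [AddCommGroup F] [Module K F] [FiniteDimensional K E] [FiniteDimensional K F]
    {BE : LinearMap.BilinForm K E} {BF : LinearMap.BilinForm K F} (hE : BE.Nondegenerate)
    (hF : BF.Nondegenerate) {Φ : E →ₗ[K] F} {Ψ : F →ₗ[K] E}
    (h : ∀ a y, BF (Φ a) y = BE a (Ψ y)) :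
    finrank K (LinearMap.ker Φ) + finrank K F = finrank K (LinearMap.ker Ψ) + finrank K E := by
  have h1 : LinearMap.ker Ψ = BF.orthogonal (LinearMap.range Φ) := by
    ext y
    rw [LinearMap.mem_ker, LinearMap.BilinForm.mem_orthogonal_iff]
    constructor
    · rintro hy _ ⟨a, rfl⟩
      show BF (Φ a) y = 0
      rw [h, hy, map_zero]
    · intro hy
      exact hE.2 _ fun a => by rw [← h]; exact hy _ ⟨a, rfl⟩
  have h2 := LinearMap.BilinForm.finrank_orthogonal hF (LinearMap.range Φ)
  have h3 := Φ.finrank_range_add_finrank_ker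
  have h4 := (LinearMap.range Φ).finrank_le
  rw [h1]
  omega

theorem trace_inv_apply_mul (g : L ≃ₐ[K] L) (x y : L) :
    Algebra.trace K L (g⁻¹ x * y) = Algebra.trace K L (x * g y) := by
  rw [← Algebra.trace_eq_of_algEquiv g, map_mul, ← AlgEquiv.mul_apply, mul_inv_cancel,
    AlgEquiv.one_apply]

end GoldType

namespace GoldType

open Module

set_option linter.unusedSectionVars false

/-! ### Counting the polar forms with prescribed vectors in the radical -/

variable {K L : Type*} [Field K] [Field L] [Algebra K L] [FiniteDimensional K L]
variable {ι : Type*} [Fintype ι]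

/-- Evaluation of the polar operators at a family of vectors. -/
noncomputable def evalPolar (ρ : ι → L ≃ₐ[K] L) {r : ℕ} (u : Fin r → L) :
    (ι → L) →ₗ[K] (Fin r → L) where
  toFun a i := polarOp ρ a (u i)
  map_add' a b := by
    ext i
    simp only [polarOp_apply, Pi.add_apply, add_mul, map_add, ← Finset.sum_add_distrib]
    exact Finset.sum_congr rfl fun j _ => by ring
  map_smul' c a := by
    ext i
    simp only [polarOp_apply, Pi.smul_apply, smul_mul_assoc, map_smul, RingHom.id_apply,
      Finset.smul_sum, smul_add]

/-- The adjoint of `evalPolar`. -/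
noncomputable def coPolar (ρ : ι → L ≃ₐ[K] L) {r : ℕ} (u : Fin r → L) :
    (Fin r → L) →ₗ[K] (ι → L) where
  toFun y j := ∑ i, (ρ j (u i) * y i + u i * ρ j (y i))
  map_add' y z := by
    ext j
    simp only [Pi.add_apply, map_add, ← Finset.sum_add_distrib]
    exact Finset.sum_congr rfl fun i _ => by ring
  map_smul' c y := by
    ext j
    simp only [Pi.smul_apply, mul_smul_comm, map_smul, RingHom.id_apply, Finset.smul_sum, smul_add]

theorem evalPolar_apply (ρ : ι → L ≃ₐ[K] L) {r : ℕ} (u : Fin r → L) (a : ι → L) (i : Fin r) :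
    evalPolar ρ u a i = polarOp ρ a (u i) := rfl

theorem coPolar_apply (ρ : ι → L ≃ₐ[K] L) {r : ℕ} (u y : Fin r → L) (j : ι) :
    coPolar ρ u y j = ∑ i, (ρ j (u i) * y i + u i * ρ j (y i)) := rfl

theorem piTraceForm_evalPolar (ρ : ι → L ≃ₐ[K] L) {r : ℕ} (u : Fin r → L) (a : ι → L)
    (y : Fin r → L) :
    piTraceForm K L (Fin r) (evalPolar ρ u a) y = piTraceForm K L ι a (coPolar ρ u y) := by
  simp only [piTraceForm_apply, evalPolar_apply, coPolar_apply, polarOp_apply, Finset.sum_mul,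
    Finset.mul_sum, map_sum]
  rw [Finset.sum_comm]
  refine Finset.sum_congr rfl fun j _ => Finset.sum_congr rfl fun i _ => ?_
  rw [add_mul, mul_add, map_add, map_add, trace_inv_apply_mul]
  simp only [mul_assoc]

/-- The map factors through `2r` trace functionals, so its rank is at most `2r`. -/
theorem finrank_le_finrank_ker_add_of_trace [IsGalois K L] {r : ℕ} (u y : Fin r → L)
    {f : L →ₗ[K] L}
    (hf : ∀ x, f x = ∑ i, (Algebra.trace K L (y i * x) • u i + Algebra.trace K L (u i * x) • y i)) :
    finrank K L ≤ finrank K (LinearMap.ker f) + 2 * r := by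
  let φ : L →ₗ[K] (Fin r → K) × (Fin r → K) :=
    (LinearMap.pi fun i => Algebra.traceForm K L (y i)).prod
      (LinearMap.pi fun i => Algebra.traceForm K L (u i))
  have h1 : LinearMap.ker φ ≤ LinearMap.ker f := by
    intro x hx
    have hx' := Prod.ext_iff.1 (LinearMap.mem_ker.1 hx)
    have hy : ∀ i, Algebra.trace K L (y i * x) = 0 := fun i => congrFun hx'.1 i
    have hu : ∀ i, Algebra.trace K L (u i * x) = 0 := fun i => congrFun hx'.2 i
    rw [LinearMap.mem_ker, hf]
    simp [hy, hu]
  have h2 := Submodule.finrank_mono h1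
  have h3 := φ.finrank_range_add_finrank_ker
  have h4 : finrank K (LinearMap.range φ) ≤ 2 * r := by
    refine (LinearMap.range φ).finrank_le.trans ?_
    rw [finrank_prod, finrank_fin_fun]
    omega
  omega

/-- Expanding traces as sums over the Galois group, the coefficient at `g` is `∑ (g(u_i) y_i + u_i
g(y_i))`. It vanishes at `1` by characteristic two, and at each `ρ_j` and `ρ_j⁻¹` by hypothesis. A
nonzero operator of this support has rank above `2 * card ι` by `cothin`, against rank at most `2r`.
-/
theorem IsGoldSystem.sum_trace_smul_eq_zero [IsGalois K L] [CharP L 2] {ρ : ι → L ≃ₐ[K] L}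
    (hρ : IsGoldSystem ρ) {r : ℕ} (hr : r ≤ Fintype.card ι) {u y : Fin r → L}
    (hy : coPolar ρ u y = 0) (x : L) :
    ∑ i, (Algebra.trace K L (y i * x) • u i + Algebra.trace K L (u i * x) • y i) = 0 := by
  set C : (L ≃ₐ[K] L) → L := fun g => ∑ i, (g (u i) * y i + u i * g (y i)) with hC
  have hop : ∀ x, galOp C x =
      ∑ i, (Algebra.trace K L (y i * x) • u i + Algebra.trace K L (u i * x) • y i) := by
    intro x
    rw [galOp_apply]
    simp only [hC, Algebra.smul_def, trace_eq_sum_automorphisms, Finset.sum_mul, map_mul]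
    rw [Finset.sum_comm]
    refine Finset.sum_congr rfl fun i _ => ?_
    rw [← Finset.sum_add_distrib]
    exact Finset.sum_congr rfl fun g _ => by ring
  rw [← hop]
  by_cases hC0 : C = 0
  · rw [galOp_apply, hC0]
    simp
  have h1 := hρ.cothin C hC0 ?_
  · have h2 := finrank_le_finrank_ker_add_of_trace u y hop
    omega
  · intro g hg
    have hj : ∀ j, C (ρ j) = 0 := fun j => congrFun hy j
    refine ⟨?_, fun j => ⟨?_, ?_⟩⟩
    · rintro rfl
      refine hg (Finset.sum_eq_zero fun i _ => ?_)
      simp only [AlgEquiv.one_apply]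
      exact CharTwo.add_self_eq_zero _
    · rintro rfl
      exact hg (hj j)
    · rintro rfl
      refine hg ((map_eq_zero_iff _ (ρ j).injective).1 ?_)
      rw [← hj j]
      have hinv : ∀ z, ρ j ((ρ j)⁻¹ z) = z := fun z => by
        rw [← AlgEquiv.mul_apply, mul_inv_cancel, AlgEquiv.one_apply]
      simp only [hC, map_sum, map_add, map_mul, hinv]
      exact Finset.sum_congr rfl fun i _ => by ring

/-- Coordinate functionals on the span of `u` extend to `L` and are represented by the nondegenerate
trace form. -/
theorem exists_trace_dual [Algebra.IsSeparable K L] {r : ℕ} {u : Fin r → L}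
    (hu : LinearIndependent K u) :
    ∃ x : Fin r → L, ∀ i j, Algebra.trace K L (u i * x j) = if i = j then 1 else 0 := by
  classical
  obtain ⟨g, hg⟩ := (Finsupp.linearCombination K u).exists_leftInverse_of_injective
    (LinearMap.ker_eq_bot.2 hu)
  have hB := traceForm_nondegenerate K L
  refine ⟨fun j => ((Algebra.traceForm K L).toDual hB).symm (Finsupp.lapply j ∘ₗ g), fun i j => ?_⟩
  have h1 := LinearMap.BilinForm.apply_toDual_symm_apply (hB := hB)
    (f := Finsupp.lapply j ∘ₗ g) (v := u i)
  rw [Algebra.traceForm_apply, mul_comm] at h1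
  rw [h1, LinearMap.comp_apply]
  have h2 := LinearMap.congr_fun hg (Finsupp.single i 1)
  simp only [LinearMap.comp_apply, Finsupp.linearCombination_single, one_smul,
    LinearMap.id_apply] at h2
  rw [h2]
  simp [Finsupp.single_apply]

/-- The families obtained from `u` by applying a symmetric matrix. -/
noncomputable def symCombination (K : Type*) [Field K] [Algebra K L] {r : ℕ} (u : Fin r → L) :
    (Sym2 (Fin r) → K) →ₗ[K] (Fin r → L) where
  toFun M i := ∑ l, M s(i, l) • u l
  map_add' M N := by
    ext i
    simp [add_smul, Finset.sum_add_distrib]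
  map_smul' c M := by
    ext i
    simp [Finset.smul_sum, mul_smul]

theorem symCombination_apply {r : ℕ} (u : Fin r → L) (M : Sym2 (Fin r) → K) (i : Fin r) :
    symCombination K u M i = ∑ l, M s(i, l) • u l := rfl

theorem symCombination_injective {r : ℕ} {u : Fin r → L} (hu : LinearIndependent K u) :
    Function.Injective (symCombination K u) := by
  rw [injective_iff_map_eq_zero]
  intro M hM
  ext z
  induction z using Sym2.ind with
  | _ i l =>
    exact Fintype.linearIndependent_iff.1 hu (fun l => M s(i, l)) (congrFun hM i) l

/-- Evaluating the vanishing operator on a dual family `x` gives `y_j = ∑ Tr(y_i x_j) u_i`; pairing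
this with `x` again shows the matrix to be symmetric. Conversely, for a symmetric matrix the two
sums coincide and cancel in characteristic two. -/
theorem IsGoldSystem.ker_coPolar [IsGalois K L] [CharP L 2] {ρ : ι → L ≃ₐ[K] L}
    (hρ : IsGoldSystem ρ) {r : ℕ} (hr : r ≤ Fintype.card ι) {u : Fin r → L}
    (hu : LinearIndependent K u) :
    LinearMap.ker (coPolar ρ u) = LinearMap.range (symCombination K u) := by
  apply le_antisymm
  · intro y hy
    have hA := hρ.sum_trace_smul_eq_zero hr (LinearMap.mem_ker.1 hy)
    obtain ⟨x, hx⟩ := exists_trace_dual hu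
    have h1 : ∀ j, y j = ∑ i, Algebra.trace K L (y i * x j) • u i := by
      intro j
      have := hA (x j)
      rw [Finset.sum_add_distrib] at this
      simp only [hx, ite_smul, one_smul, zero_smul, Finset.sum_ite_eq', Finset.mem_univ,
        if_true] at this
      rw [CharTwo.add_eq_zero.1 this]
    have hsymm : ∀ i j, Algebra.trace K L (y i * x j) = Algebra.trace K L (y j * x i) := by
      intro i j
      conv_lhs => rw [h1 i]
      rw [Finset.sum_mul, map_sum]
      simp [hx]
    refine ⟨Sym2.lift ⟨fun i j => Algebra.trace K L (y i * x j), hsymm⟩, ?_⟩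
    ext i
    rw [symCombination_apply, h1 i]
    exact Finset.sum_congr rfl fun l _ => by rw [Sym2.lift_mk, hsymm]
  · rintro _ ⟨M, rfl⟩
    rw [LinearMap.mem_ker]
    ext j
    rw [coPolar_apply, Finset.sum_add_distrib]
    simp only [symCombination_apply, map_sum, map_smul, Finset.mul_sum, mul_smul_comm]
    conv_lhs =>
      right
      rw [Finset.sum_comm]
    rw [← Finset.sum_add_distrib]
    refine Finset.sum_eq_zero fun i _ => ?_
    rw [← Finset.sum_add_distrib]
    refine Finset.sum_eq_zero fun l _ => ?_
    rw [Sym2.eq_swap, mul_comm (u l)]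
    exact CharTwo.add_self_eq_zero _

theorem IsGoldSystem.finrank_ker_evalPolar [IsGalois K L] [CharP L 2] {ρ : ι → L ≃ₐ[K] L}
    (hρ : IsGoldSystem ρ) {r : ℕ} (hr : r ≤ Fintype.card ι) {u : Fin r → L}
    (hu : LinearIndependent K u) :
    finrank K (LinearMap.ker (evalPolar ρ u)) + r * finrank K L =
      (r + 1).choose 2 + Fintype.card ι * finrank K L := by
  have h := finrank_ker_add_finrank_of_adjoint (piTraceForm_nondegenerate (K := K) (L := L))
    (piTraceForm_nondegenerate (K := K) (L := L)) (piTraceForm_evalPolar ρ u)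
  rw [hρ.ker_coPolar hr hu, LinearMap.finrank_range_of_inj (symCombination_injective hu),
    finrank_fintype_fun_eq_card, Sym2.card, finrank_pi_fintype, finrank_pi_fintype] at h
  simpa using h

theorem natCard_linearIndependent_cast (K V : Type*) [Field K] [AddCommGroup V] [Module K V]
    [Finite K] [Finite V] (r : ℕ) :
    (Nat.card {s : Fin r → V // LinearIndependent K s} : ℚ) =
      ∏ l ∈ Finset.range r, ((Nat.card K : ℚ) ^ finrank K V - (Nat.card K : ℚ) ^ l) := by
  have := Fintype.ofFinite K
  rcases le_or_gt r (finrank K V) with h | h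
  · rw [card_linearIndependent h, Nat.cast_prod, Finset.prod_range, Nat.card_eq_fintype_card]
    refine Finset.prod_congr rfl fun i _ => ?_
    rw [Nat.cast_sub (Nat.pow_le_pow_right Fintype.card_pos (by omega))]
    push_cast
    rfl
  · rw [Finset.prod_eq_zero (Finset.mem_range.2 h) (sub_self _)]
    have : IsEmpty {s : Fin r → V // LinearIndependent K s} :=
      ⟨fun s => by simpa using s.2.fintype_card_le_finrank.trans_lt h⟩
    simp

theorem prod_pow_succ_eq {R : Type*} [CommMonoid R] (q : R) (r : ℕ) :
    ∏ l ∈ Finset.range r, q ^ (l + 1) = q ^ (r + 1).choose 2 := by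
  induction r with
  | zero => simp
  | succ r ih =>
    rw [Finset.prod_range_succ, ih, ← pow_add, Nat.choose_succ_succ' (r + 1) 1,
      Nat.choose_one_right, add_comm]

theorem natCard_linearIndependent_submodule {K V : Type*} [Field K] [AddCommGroup V] [Module K V]
    (W : Submodule K V) (r : ℕ) :
    Nat.card {s : Fin r → W // LinearIndependent K s} =
      Nat.card {u : Fin r → V // LinearIndependent K u ∧ ∀ i, u i ∈ W} :=
  Nat.card_congr
    { toFun := fun s => ⟨W.subtype ∘ s.1,
        (LinearMap.linearIndependent_iff _ W.ker_subtype).2 s.2, fun i => (s.1 i).2⟩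
      invFun := fun u => ⟨fun i => ⟨u.1 i, u.2.2 i⟩,
        (LinearMap.linearIndependent_iff W.subtype W.ker_subtype).1 u.2.1⟩
      left_inv := fun _ => rfl
      right_inv := fun _ => rfl }

/-- The averages of `∏_{l < r} (|rad| - q ^ l)` over the polar forms of a Gold system. -/
theorem IsGoldSystem.sum_prod_card_ker [Finite K] [Fintype L] [DecidableEq ι] [CharP L 2]
    {ρ : ι → L ≃ₐ[K] L} (hρ : IsGoldSystem ρ) {r : ℕ} (hr : r ≤ Fintype.card ι) :
    ∑ a : ι → L, ∏ l ∈ Finset.range r,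
        ((Nat.card K : ℚ) ^ finrank K (LinearMap.ker (polarOp ρ a)) - (Nat.card K : ℚ) ^ l) =
      (Nat.card K : ℚ) ^ (finrank K L * Fintype.card ι) * ∏ l ∈ Finset.range r,
        ((Nat.card K : ℚ) ^ (l + 1) *
          (1 - (Nat.card K : ℚ) ^ l * ((Nat.card K : ℚ) ^ finrank K L)⁻¹)) := by
  classical
  have hq : (Nat.card K : ℚ) ≠ 0 := by exact_mod_cast Nat.card_pos.ne'
  set q : ℚ := (Nat.card K : ℚ) with hqdef
  have h1 : ∀ a : ι → L, ∏ l ∈ Finset.range r,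
      (q ^ finrank K (LinearMap.ker (polarOp ρ a)) - q ^ l) =
      ∑ u : Fin r → L, if LinearIndependent K u ∧ evalPolar ρ u a = 0 then (1 : ℚ) else 0 := by
    intro a
    rw [hqdef, ← natCard_linearIndependent_cast, natCard_linearIndependent_submodule,
      Nat.card_eq_fintype_card, Fintype.card_subtype, Finset.sum_boole]
    congr 2
    ext u
    simp [funext_iff, evalPolar_apply]
  -- The right side does not depend on `u`, so counting pairs `(a, u)` reduces to counting
  -- independent families.
  have h2 : ∀ u : Fin r → L, LinearIndependent K u →
      ∑ a : ι → L, (if evalPolar ρ u a = 0 then (1 : ℚ) else 0) =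
        q ^ (finrank K L * Fintype.card ι) * (∏ l ∈ Finset.range r, q ^ (l + 1)) *
          ((q ^ finrank K L)⁻¹) ^ r := by
    intro u hu
    have hd := hρ.finrank_ker_evalPolar hr hu
    have hc : Nat.card (LinearMap.ker (evalPolar ρ u)) =
        Nat.card K ^ finrank K (LinearMap.ker (evalPolar ρ u)) :=
      Module.natCard_eq_pow_finrank
    have hs : ∑ a : ι → L, (if evalPolar ρ u a = 0 then (1 : ℚ) else 0) =
        Nat.card (LinearMap.ker (evalPolar ρ u)) := by
      rw [Finset.sum_boole, Nat.card_eq_fintype_card, Fintype.card_subtype]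
      congr 2
      ext a
      simp
    rw [hs, hc, Nat.cast_pow, ← hqdef, prod_pow_succ_eq, inv_pow, ← pow_mul, ← pow_add,
      eq_mul_inv_iff_mul_eq₀ (pow_ne_zero _ hq), ← pow_add]
    congr 1
    linarith
  simp_rw [h1]
  rw [Finset.sum_comm]
  have h3 : ∀ u : Fin r → L, ∑ a : ι → L,
      (if LinearIndependent K u ∧ evalPolar ρ u a = 0 then (1 : ℚ) else 0) =
      (if LinearIndependent K u then (1 : ℚ) else 0) * (q ^ (finrank K L * Fintype.card ι) *
        (∏ l ∈ Finset.range r, q ^ (l + 1)) * ((q ^ finrank K L)⁻¹) ^ r) := by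
    intro u
    by_cases hu : LinearIndependent K u
    · simp only [hu, true_and, if_true, one_mul]
      exact h2 u hu
    · simp [hu]
  simp_rw [h3]
  rw [← Finset.sum_mul, Finset.sum_boole, ← Fintype.card_subtype, ← Nat.card_eq_fintype_card,
    natCard_linearIndependent_cast, ← hqdef, Finset.prod_mul_distrib]
  have h4 : ∏ l ∈ Finset.range r, (1 - q ^ l * (q ^ finrank K L)⁻¹) =
      (∏ l ∈ Finset.range r, (q ^ finrank K L - q ^ l)) * ((q ^ finrank K L)⁻¹) ^ r := by
    conv_rhs => rw [← Finset.card_range r, ← Finset.prod_const, Finset.card_range,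
      ← Finset.prod_mul_distrib]
    refine Finset.prod_congr rfl fun l _ => ?_
    rw [sub_mul, mul_inv_cancel₀ (pow_ne_zero _ hq)]
  rw [h4]
  ring

end GoldType

namespace GoldType

open Module

set_option linter.unusedSectionVars false

/-! ### The rank distribution -/

/-- The rank of an alternating form is even. -/
theorem exists_two_mul_eq_finrank_add_finrank_radical {K V : Type*} [Field K] [AddCommGroup V]
    [Module K V] [FiniteDimensional K V] {B : LinearMap.BilinForm K V} (hB : B.IsAlt) :
    ∃ w, 2 * w = finrank K V + finrank K (B.orthogonal ⊤) := by
  have hrefl : B.IsRefl := hB.isRefl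
  -- A maximal totally isotropic `W` equals its own orthogonal: any further orthogonal vector could
  -- be adjoined, being isotropic itself. Since `W` contains the radical, the dimension formula
  -- gives twice `dim W`.
  obtain ⟨W, hW, hmax⟩ := (wellFounded_gt (α := Submodule K V)).has_min
    {W | W ≤ B.orthogonal W} ⟨⊥, by simp⟩
  have heq : B.orthogonal W = W := by
    refine le_antisymm (fun v hv => ?_) hW
    by_contra hvW
    refine hmax (W ⊔ Submodule.span K {v}) ?_ ?_
    · intro x hx
      rw [LinearMap.BilinForm.mem_orthogonal_iff] at hv ⊢
      intro y hy
      obtain ⟨w, hw, z, hz, rfl⟩ := Submodule.mem_sup.1 hx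
      obtain ⟨w', hw', z', hz', rfl⟩ := Submodule.mem_sup.1 hy
      obtain ⟨c, rfl⟩ := Submodule.mem_span_singleton.1 hz
      obtain ⟨c', rfl⟩ := Submodule.mem_span_singleton.1 hz'
      have h1 : B w' w = 0 := (LinearMap.BilinForm.mem_orthogonal_iff.1 (hW hw)) w' hw'
      have h2 : B w' v = 0 := hv w' hw'
      have h3 : B v w = 0 := hrefl _ _ (hv w hw)
      have h4 : B v v = 0 := hB v
      show B (w' + c' • v) (w + c • v) = 0
      simp [h1, h2, h3, h4]
    · exact lt_of_le_of_ne le_sup_left fun h => hvW (h ▸ Submodule.mem_sup_right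
        (Submodule.mem_span_singleton_self v))
  have h := LinearMap.BilinForm.finrank_add_finrank_orthogonal hrefl W
  have hle : B.orthogonal ⊤ ≤ W := by
    rw [← heq]
    exact LinearMap.BilinForm.orthogonal_le le_top
  rw [heq, inf_eq_right.2 hle] at h
  exact ⟨finrank K W, by omega⟩

variable {K L : Type*} [Field K] [Field L] [Algebra K L] [FiniteDimensional K L]
variable {ι : Type*} [Fintype ι]

theorem exists_finrank_ker_polarOp_eq [Algebra.IsSeparable K L] [CharP L 2] (ρ : ι → L ≃ₐ[K] L)
    (a : ι → L) {h : ℕ} (hn : finrank K L = 2 * h + 1) :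
    ∃ x, finrank K (LinearMap.ker (polarOp ρ a)) = 2 * x + 1 := by
  have : CharP K 2 := (algebraMap K L).charP (algebraMap K L).injective 2
  let B : LinearMap.BilinForm K L := Algebra.traceForm K L ∘ₗ polarOp ρ a
  have hBapp : ∀ x y, B x y = Algebra.trace K L (polarOp ρ a x * y) := fun _ _ => rfl
  have hB : B.IsAlt := by
    intro x
    rw [hBapp, polarOp_apply, Finset.sum_mul, map_sum]
    refine Finset.sum_eq_zero fun j _ => ?_
    rw [add_mul, map_add, trace_inv_apply_mul, mul_right_comm]
    exact CharTwo.add_self_eq_zero _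
  have hker : B.orthogonal ⊤ = LinearMap.ker (polarOp ρ a) := by
    ext x
    rw [LinearMap.BilinForm.mem_orthogonal_iff, LinearMap.mem_ker]
    constructor
    · intro hx
      refine eq_zero_of_trace_mul_eq_zero (K := K) fun y => ?_
      exact hB.isRefl _ _ (hx y trivial)
    · intro hx y _
      refine hB.isRefl _ _ ?_
      rw [hBapp, hx, zero_mul, map_zero]
  obtain ⟨w, hw⟩ := exists_two_mul_eq_finrank_add_finrank_radical hB
  rw [hker, hn] at hw
  exact ⟨(finrank K (LinearMap.ker (polarOp ρ a)) - 1) / 2, by omega⟩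

theorem polarOp_zero (ρ : ι → L ≃ₐ[K] L) : polarOp ρ 0 = 0 := by
  ext x
  simp [polarOp_apply]

/-- The number of polar forms of a Gold system with radical of given dimension. -/
theorem IsGoldSystem.card_finrank_ker_eq [Finite K] [Finite L] [CharP L 2] {ρ : ι → L ≃ₐ[K] L}
    (hρ : IsGoldSystem ρ) {h : ℕ} (hn : finrank K L = 2 * h + 1) (hpos : 0 < Fintype.card ι)
    (hle : Fintype.card ι ≤ h) {i : ℕ} (hi : i ≤ Fintype.card ι - 1) :
    (Nat.card {a : ι → L // finrank K (LinearMap.ker (polarOp ρ a)) = 2 * i + 1} : ℚ) =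
      ∑ j ∈ Finset.Icc i (Fintype.card ι - 1),
        (-1) ^ (j - i) * ((Nat.card K : ℚ) ^ 2) ^ (j - i).choose 2 *
          gaussBinom ((Nat.card K : ℚ) ^ 2) j i *
          (gaussBinom ((Nat.card K : ℚ) ^ 2) h j *
            ((Nat.card K : ℚ) ^ (finrank K L * (Fintype.card ι - j)) - 1)) := by
  classical
  have := Fintype.ofFinite L
  set q : ℚ := (Nat.card K : ℚ) with hqdef
  have hq : 1 < q := by
    rw [hqdef]
    exact_mod_cast Finite.one_lt_card
  have hQ : 1 < q ^ 2 := one_lt_pow₀ hq two_ne_zero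
  choose x hx using fun a => exists_finrank_ker_polarOp_eq ρ a hn
  have hx0 : x 0 = h := by
    have := hx 0
    rw [polarOp_zero, LinearMap.ker_zero, finrank_top, hn] at this
    omega
  -- From `2x + 1 ≤ 2κ` parity yields `x < κ`: as many unknowns as moments of index below `κ`.
  have hxle : ∀ a, a ≠ 0 → x a < Fintype.card ι := by
    intro a ha
    have h1 := hρ.finrank_ker_polarOp_le ha
    rw [hx a] at h1
    omega
  have hmom : ∀ j ≤ Fintype.card ι, ∑ a : ι → L, gaussBinom (q ^ 2) (x a) j =
      q ^ ((2 * h + 1) * (Fintype.card ι - j)) * gaussBinom (q ^ 2) h j := by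
    intro j hj
    refine sum_gaussBinom_sq Finset.univ x hq (fun r hr => ?_) hj
    have := hρ.sum_prod_card_ker hr
    simp only [hx, hn, ← hqdef] at this
    exact this
  let A : ℕ → ℚ := fun y => ((Finset.univ.filter fun a : ι → L => a ≠ 0 ∧ x a = y).card : ℚ)
  have hsum : ∀ j ≤ Fintype.card ι - 1,
      ∑ y ∈ Finset.range (Fintype.card ι - 1 + 1), A y * gaussBinom (q ^ 2) y j =
      gaussBinom (q ^ 2) h j * (q ^ ((2 * h + 1) * (Fintype.card ι - j)) - 1) := by
    intro j hj
    have h1 := hmom j (by omega)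
    -- The term `a = 0` has `x = h`; removing it produces the `- 1` in the final factor.
    rw [← Finset.add_sum_erase _ _ (Finset.mem_univ (0 : ι → L)), hx0] at h1
    have h2 : ∑ a ∈ Finset.univ.erase (0 : ι → L), gaussBinom (q ^ 2) (x a) j =
        ∑ y ∈ Finset.range (Fintype.card ι - 1 + 1), A y * gaussBinom (q ^ 2) y j := by
      rw [← Finset.sum_fiberwise_of_maps_to (g := x)
        (t := Finset.range (Fintype.card ι - 1 + 1))]
      · refine Finset.sum_congr rfl fun y _ => ?_
        rw [Finset.sum_congr rfl fun a ha => by rw [(Finset.mem_filter.1 ha).2],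
          Finset.sum_const, nsmul_eq_mul]
        congr 3
        ext a
        simp
      · intro a ha
        have := hxle a (Finset.ne_of_mem_erase ha)
        exact Finset.mem_range.2 (by omega)
    rw [← h2]
    linear_combination h1
  have hA : (Nat.card {a : ι → L // finrank K (LinearMap.ker (polarOp ρ a)) = 2 * i + 1} : ℚ) =
      A i := by
    rw [Nat.card_eq_fintype_card, Fintype.card_subtype]
    simp only [A]
    congr 2
    ext a
    rw [Finset.mem_filter, Finset.mem_filter, hx a]
    constructor
    · rintro ⟨-, h1⟩
      refine ⟨Finset.mem_univ _, ?_, by omega⟩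
      rintro rfl
      omega
    · rintro ⟨-, -, rfl⟩
      exact ⟨Finset.mem_univ _, rfl⟩
  rw [hA, gaussBinom_inversion hQ hsum hi, hn]

/-! ### Exponential sums of quadratic functions -/

/-- The nontrivial character of `𝔽₂`. -/
def sgn (z : ZMod 2) : ℤ := (-1) ^ z.val

@[simp] theorem sgn_zero : sgn 0 = 1 := rfl

theorem sgn_one : sgn 1 = -1 := rfl

theorem sgn_add (y z : ZMod 2) : sgn (y + z) = sgn y * sgn z := by
  revert y z
  decide

theorem sgn_mul_self (z : ZMod 2) : sgn z * sgn z = 1 := by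
  revert z
  decide

theorem sum_sgn_eq_zero {A : Type*} [AddCommGroup A] [Fintype A] {f : A → ZMod 2}
    (hf : ∀ x y, f (x + y) = f x + f y) (hne : ∃ x, f x ≠ 0) : ∑ x, sgn (f x) = 0 := by
  obtain ⟨a, ha⟩ := hne
  have h1 : f a = 1 := (by decide : ∀ z : ZMod 2, z ≠ 0 → z = 1) _ ha
  have h2 : ∑ x, sgn (f x) = ∑ x, sgn (f (x + a)) :=
    (Equiv.sum_comp (Equiv.addRight a) fun x => sgn (f x)).symm
  simp_rw [hf, h1, sgn_add, sgn_one, mul_neg_one, Finset.sum_neg_distrib] at h2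
  omega

section ExpSum

variable {L : Type*} [Field L] [Fintype L] [DecidableEq L] [Algebra (ZMod 2) L]

/-- The absolute trace. -/
local notation "Tr" => Algebra.trace (ZMod 2) L

theorem sum_sgn_trace_mul (b : L) :
    ∑ x, sgn (Tr (b * x)) = if b = 0 then (Fintype.card L : ℤ) else 0 := by
  split_ifs with hb
  · simp [hb]
  · refine sum_sgn_eq_zero (fun x y => by rw [mul_add, map_add]) ?_
    by_contra! h
    exact hb (eq_zero_of_trace_mul_eq_zero h)

/-- The exponential sum of a function twisted by a linear functional. -/
noncomputable def expSum (f : L → ZMod 2) (b : L) : ℤ := ∑ x, sgn (f x + Tr (b * x))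

theorem sum_expSum {f : L → ZMod 2} (hf : f 0 = 0) :
    ∑ b, expSum f b = (Fintype.card L : ℤ) := by
  simp_rw [expSum, sgn_add]
  rw [Finset.sum_comm]
  simp_rw [← Finset.mul_sum, mul_comm _ (_ : L), sum_sgn_trace_mul]
  simp [hf]

/-- Parseval's identity; the diagonal `x = y` is `x + y = 0` in characteristic two. -/
theorem sum_expSum_sq (f : L → ZMod 2) :
    ∑ b, expSum f b ^ 2 = (Fintype.card L : ℤ) ^ 2 := by
  have h1 : ∀ b, expSum f b ^ 2 =
      ∑ x, ∑ y, sgn (f x) * sgn (f y) * sgn (Tr ((x + y) * b)) := by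
    intro b
    rw [sq, expSum, Finset.sum_mul_sum]
    refine Finset.sum_congr rfl fun x _ => Finset.sum_congr rfl fun y _ => ?_
    rw [add_mul, map_add, sgn_add, sgn_add, sgn_add, mul_comm b, mul_comm b]
    ring
  have : CharP L 2 := charP_of_injective_algebraMap (algebraMap (ZMod 2) L).injective 2
  simp_rw [h1]
  rw [Finset.sum_comm]
  have h2 : ∀ x : L, ∑ b, ∑ y, sgn (f x) * sgn (f y) * sgn (Tr ((x + y) * b)) =
      (Fintype.card L : ℤ) := by
    intro x
    rw [Finset.sum_comm]
    simp_rw [← Finset.mul_sum, sum_sgn_trace_mul, CharTwo.add_eq_zero, mul_ite, mul_zero]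
    rw [Finset.sum_ite_eq]
    simp [sgn_mul_self]
  simp_rw [h2]
  simp [sq]

variable {f : L → ZMod 2} {N : L →+ L}

/-- Substituting `y = z + x` leaves `x` only in `Tr (N z * x)`, whose sum over `x` selects `N z =
0`. -/
theorem expSum_sq (hf : ∀ x y, f (x + y) = f x + f y + Tr (N x * y)) (b : L) :
    expSum f b ^ 2 = Fintype.card L * ∑ z : N.ker, sgn (f z + Tr (b * z)) := by
  have h1 : expSum f b ^ 2 = ∑ z, ∑ x, sgn (f z + Tr (b * z)) * sgn (Tr (N z * x)) := by
    rw [sq, expSum, Finset.sum_mul_sum, Finset.sum_comm]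
    have : ∀ x : L, ∑ y, sgn (f y + Tr (b * y)) * sgn (f x + Tr (b * x)) =
        ∑ z, sgn (f (z + x) + Tr (b * (z + x))) * sgn (f x + Tr (b * x)) := fun x =>
      (Equiv.sum_comp (Equiv.addRight x)
        fun y => sgn (f y + Tr (b * y)) * sgn (f x + Tr (b * x))).symm
    simp_rw [this]
    rw [Finset.sum_comm]
    refine Finset.sum_congr rfl fun z _ => Finset.sum_congr rfl fun x _ => ?_
    rw [hf, mul_add, map_add]
    simp only [sgn_add]
    have h1 := sgn_mul_self (f x)
    have h2 := sgn_mul_self (Tr (b * x))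
    linear_combination (sgn (f z) * sgn (Tr (b * z)) * sgn (Tr (N z * x))) *
      (sgn (Tr (b * x)) * sgn (Tr (b * x)) * h1 + h2)
  rw [h1]
  simp_rw [← Finset.mul_sum, sum_sgn_trace_mul, mul_ite, mul_zero]
  rw [← Finset.sum_filter, Finset.mul_sum]
  rw [← Finset.sum_subtype (p := fun z => z ∈ N.ker) (Finset.univ.filter fun z => N z = 0)
    (fun z => by simp [AddMonoidHom.mem_ker]) (fun z => (Fintype.card L : ℤ) * sgn (f z + Tr (b * z)))]
  exact Finset.sum_congr rfl fun z _ => mul_comm _ _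

/-- On `ker N` the function `f + Tr (b ·)` is additive, so its character sum is zero or full. -/
theorem expSum_sq_eq_zero_or (hf : ∀ x y, f (x + y) = f x + f y + Tr (N x * y)) (b : L) :
    expSum f b ^ 2 = 0 ∨ expSum f b ^ 2 = Fintype.card L * Nat.card N.ker := by
  rw [expSum_sq hf]
  by_cases h : ∃ z : N.ker, f z + Tr (b * z) ≠ 0
  · left
    rw [sum_sgn_eq_zero (f := fun z : N.ker => f z + Tr (b * z)) _ h, mul_zero]
    intro x y
    have hx : N x = 0 := x.2
    simp only [AddSubgroup.coe_add, hf, hx, zero_mul, map_zero, mul_add, map_add]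
    ring
  · right
    push Not at h
    simp [h]

/-- The number of twists of a quadratic function with given nonzero exponential sum. -/
theorem two_mul_card_expSum_eq (hf : ∀ x y, f (x + y) = f x + f y + Tr (N x * y)) {T t : ℤ}
    (hT : T ≠ 0) (hTt : (Fintype.card L : ℤ) = T * t)
    (hsq : (Fintype.card L : ℤ) * Nat.card N.ker = T ^ 2) {ε : ℤ} (hε : ε = 1 ∨ ε = -1) :
    2 * (Nat.card {b : L // expSum f b = ε * T} : ℤ) = t ^ 2 + ε * t := by
  have hf0 : f 0 = 0 := by
    have := hf 0 0
    simp only [add_zero, mul_zero, map_zero] at this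
    exact left_eq_add.1 this
  have hε2 : ε * ε = 1 := by rcases hε with rfl | rfl <;> norm_num
  -- Among the possible values `0`, `T`, `-T` this quadratic expression is nonzero only at `ε * T`,
  -- so the first two moments suffice.
  have hpt : ∀ b, expSum f b ^ 2 + ε * T * expSum f b =
      2 * T ^ 2 * (if expSum f b = ε * T then 1 else 0) := by
    intro b
    split_ifs with h
    · rw [h]
      linear_combination (2 * T ^ 2) * hε2
    · rcases expSum_sq_eq_zero_or hf b with h0 | h0
      · rw [h0, pow_eq_zero_iff two_ne_zero |>.1 h0]
        ring
      · rw [hsq] at h0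
        have h1 : (expSum f b - ε * T) * (expSum f b + ε * T) = 0 := by
          linear_combination h0 - T ^ 2 * hε2
        have h2 : expSum f b + ε * T = 0 := (mul_eq_zero.1 h1).resolve_left (sub_ne_zero.2 h)
        linear_combination expSum f b * h2
  have hsum : ∑ b, (expSum f b ^ 2 + ε * T * expSum f b) = (T * t) ^ 2 + ε * T * (T * t) := by
    rw [Finset.sum_add_distrib, ← Finset.mul_sum, sum_expSum_sq, sum_expSum hf0, hTt]
  simp_rw [hpt] at hsum
  rw [← Finset.mul_sum, Finset.sum_boole] at hsum
  rw [Nat.card_eq_fintype_card, Fintype.card_subtype]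
  apply mul_left_cancel₀ (pow_ne_zero 2 hT)
  linear_combination hsum

theorem expSum_ne_of_sq_ne (hf : ∀ x y, f (x + y) = f x + f y + Tr (N x * y)) {T : ℤ}
    (hT : T ≠ 0) (hsq : (Fintype.card L : ℤ) * Nat.card N.ker ≠ T ^ 2) {ε : ℤ}
    (hε : ε = 1 ∨ ε = -1) (b : L) : expSum f b ≠ ε * T := by
  intro h
  have h1 : expSum f b ^ 2 = T ^ 2 := by
    rw [h]
    rcases hε with rfl | rfl <;> ring
  rcases expSum_sq_eq_zero_or hf b with h0 | h0
  · exact pow_ne_zero 2 hT (h1.symm.trans h0)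
  · exact hsq (h0.symm.trans h1)

end ExpSum

end GoldType

namespace GoldType

open Module Polynomial

/-! ### The field generated by a maximum-length sequence -/

section Register

variable {n : ℕ}

/-- The shift by one place as an operator. -/
def shiftOp (n : ℕ) : BinSeq n →ₗ[ZMod 2] BinSeq n where
  toFun := shift 1
  map_add' _ _ := rfl
  map_smul' _ _ := rfl

theorem shiftOp_apply (w : BinSeq n) (t : ZMod n) : shiftOp n w t = w (t + 1) := rfl

theorem shiftOp_pow_apply (u : ℕ) (w : BinSeq n) : (shiftOp n ^ u) w = shift (u : ZMod n) w := by
  induction u with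
  | zero => ext t; simp [shift]
  | succ u ih =>
    rw [pow_succ', Module.End.mul_apply, ih]
    ext t
    rw [shiftOp_apply]
    simp only [shift]
    congr 1
    push_cast
    ring

/-- The sequences satisfying a given linear recurrence. -/
def recurrenceSpace {m : ℕ} (a : Fin m → ZMod 2) : Submodule (ZMod 2) (BinSeq n) where
  carrier := {w | ∀ t, w (t + (m : ZMod n)) = ∑ l : Fin m, a l * w (t + ((l : ℕ) : ZMod n))}
  add_mem' {v w} hv hw t := by
    simp only [Pi.add_apply, mul_add, Finset.sum_add_distrib, hv t, hw t]
  zero_mem' t := by simp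
  smul_mem' c w hw t := by
    simp only [Pi.smul_apply, smul_eq_mul, hw t, Finset.mul_sum, mul_left_comm]

variable {m : ℕ} {a : Fin m → ZMod 2}

theorem shiftOp_mem_recurrenceSpace {w : BinSeq n} (hw : w ∈ recurrenceSpace a) :
    shiftOp n w ∈ recurrenceSpace a := by
  intro t
  simp only [shiftOp_apply]
  rw [add_right_comm, hw (t + 1)]
  exact Finset.sum_congr rfl fun l _ => by rw [add_right_comm]

theorem aeval_shiftOp_mem_recurrenceSpace {w : BinSeq n} (hw : w ∈ recurrenceSpace a)
    (f : (ZMod 2)[X]) : aeval (shiftOp n) f w ∈ recurrenceSpace a := by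
  induction f using Polynomial.induction_on' with
  | add p q hp hq =>
    rw [map_add]
    exact Submodule.add_mem _ hp hq
  | monomial k c =>
    rw [aeval_monomial, Module.End.mul_apply]
    refine Submodule.smul_mem _ c ?_
    induction k with
    | zero => exact hw
    | succ k ih =>
      rw [pow_succ', Module.End.mul_apply]
      exact shiftOp_mem_recurrenceSpace ih

theorem eq_zero_of_mem_recurrenceSpace [NeZero n] {w : BinSeq n} (hw : w ∈ recurrenceSpace a)
    (h0 : ∀ l : Fin m, w ((l : ℕ) : ZMod n) = 0) : w = 0 := by
  have key : ∀ t : ℕ, w (t : ZMod n) = 0 := by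
    intro t
    induction t using Nat.strong_induction_on with
    | _ t ih =>
      rcases lt_or_ge t m with h | h
      · exact h0 ⟨t, h⟩
      · obtain ⟨v, rfl⟩ := Nat.exists_eq_add_of_le' h
        rw [Nat.cast_add, hw v]
        refine Finset.sum_eq_zero fun l _ => ?_
        rw [← Nat.cast_add, ih (v + l) (by omega), mul_zero]
  ext t
  rw [← ZMod.natCast_zmod_val t]
  exact key _

theorem natCard_recurrenceSpace_le [NeZero n] (a : Fin m → ZMod 2) :
    Nat.card (recurrenceSpace (n := n) a) ≤ 2 ^ m := by
  have hinj : Function.Injective fun (w : recurrenceSpace (n := n) a) (l : Fin m) =>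
      w.1 ((l : ℕ) : ZMod n) := by
    intro v w h
    have h1 : (v - w : recurrenceSpace (n := n) a).1 = 0 := by
      refine eq_zero_of_mem_recurrenceSpace (v - w).2 fun l => ?_
      simpa [sub_eq_zero] using congrFun h l
    exact sub_eq_zero.1 (Subtype.ext h1)
  refine (Nat.card_le_card_of_injective _ hinj).trans_eq ?_
  simp

end Register

variable {m : ℕ}

theorem shift_injective_of_isMaximumLength {s : BinSeq (2 ^ m - 1)} (hs : IsMaximumLength m s) :
    Function.Injective fun u => shift u s := by
  intro u v h
  refine sub_eq_zero.1 (hs.2.2 (u - v) ?_)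
  ext t
  have := congrFun h (t - v)
  simp only [shift] at this ⊢
  rw [sub_add_cancel] at this
  rw [← this]
  congr 1
  ring

theorem shift_ne_zero {n : ℕ} {s : BinSeq n} (hs : s ≠ 0) (u : ZMod n) : shift u s ≠ 0 := by
  intro h
  refine hs (funext fun t => ?_)
  have := congrFun h (t - u)
  simpa [shift] using this

/-- The annihilator of a sequence under the shift operator. -/
noncomputable def annIdeal {n : ℕ} (s : BinSeq n) : Ideal (ZMod 2)[X] where
  carrier := {f | aeval (shiftOp n) f s = 0}
  add_mem' {f g} hf hg := by
    simp only [Set.mem_ofPred_eq] at *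
    rw [map_add, LinearMap.add_apply, hf, hg, add_zero]
  zero_mem' := by simp
  smul_mem' g f hf := by
    simp only [Set.mem_ofPred_eq, smul_eq_mul] at *
    rw [map_mul, Module.End.mul_apply, hf, map_zero]

theorem mem_annIdeal {n : ℕ} {s : BinSeq n} {f : (ZMod 2)[X]} :
    f ∈ annIdeal s ↔ aeval (shiftOp n) f s = 0 := Iff.rfl

theorem aeval_X_pow_shiftOp {n : ℕ} (s : BinSeq n) (u : ℕ) :
    aeval (shiftOp n) ((X : (ZMod 2)[X]) ^ u) s = shift (u : ZMod n) s := by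
  rw [map_pow, aeval_X, shiftOp_pow_apply]

/-- A maximum-length sequence is `t ↦ φ(γ ^ t)` for a primitive element `γ` of a field with
`2 ^ m` elements and a linear functional `φ`. -/
theorem IsMaximumLength.exists_field (hm : 0 < m) {s : BinSeq (2 ^ m - 1)}
    (hs : IsMaximumLength m s) :
    ∃ (L : Type) (_ : Field L) (_ : Fintype L) (_ : Algebra (ZMod 2) L) (γ b : L),
      Fintype.card L = 2 ^ m ∧ b ≠ 0 ∧ γ ^ (2 ^ m - 1) = 1 ∧
      (∀ x : L, x ≠ 0 → ∃ u < 2 ^ m - 1, x = γ ^ u) ∧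
      ∀ t : ℕ, s (t : ZMod (2 ^ m - 1)) = Algebra.trace (ZMod 2) L (b * γ ^ t) := by
  have hm1 : 2 ≤ 2 ^ m := le_self_pow₀ one_le_two hm.ne'
  have : NeZero (2 ^ m - 1) := ⟨by omega⟩
  obtain ⟨a, ha⟩ := hs.2.1
  have hsR : s ∈ recurrenceSpace a := ha
  have hshift : ∀ u : ZMod (2 ^ m - 1), shift u s ∈ recurrenceSpace a := by
    intro u
    have := aeval_shiftOp_mem_recurrenceSpace hsR (X ^ u.val)
    rwa [aeval_X_pow_shiftOp, ZMod.natCast_zmod_val] at this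
  -- Zero and the `2 ^ m - 1` distinct shifts of `s` exhaust the recurrence space, which has at most
  -- `2 ^ m` elements.
  let g : Option (ZMod (2 ^ m - 1)) → recurrenceSpace (n := 2 ^ m - 1) a
    | none => 0
    | some u => ⟨shift u s, hshift u⟩
  have hg : Function.Injective g := by
    rintro (_ | u) (_ | v) h
    · rfl
    · exact absurd (congrArg Subtype.val h).symm (shift_ne_zero hs.1 v)
    · exact absurd (congrArg Subtype.val h) (shift_ne_zero hs.1 u)
    · rw [shift_injective_of_isMaximumLength hs (congrArg Subtype.val h)]
  have hcard : Nat.card (Option (ZMod (2 ^ m - 1))) = 2 ^ m := by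
    rw [Finite.card_option, Nat.card_zmod]
    omega
  have hbij := hg.bijective_of_nat_card_le
    ((natCard_recurrenceSpace_le (n := 2 ^ m - 1) a).trans_eq hcard.symm)
  have hnonzero : ∀ w ∈ recurrenceSpace (n := 2 ^ m - 1) a, w ≠ 0 →
      ∃ u : ZMod (2 ^ m - 1), w = shift u s := by
    intro w hw hw0
    obtain ⟨x, hx⟩ := hbij.2 ⟨w, hw⟩
    rcases x with _ | u
    · exact absurd (congrArg Subtype.val hx).symm hw0
    · exact ⟨u, (congrArg Subtype.val hx).symm⟩
  -- Modulo the annihilator every nonzero polynomial is a power of `X`. This yields both maximality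
  -- of the ideal and primitivity of the class of `X`.
  have hpow : ∀ f : (ZMod 2)[X], f ∉ annIdeal s →
      ∃ u < 2 ^ m - 1, f - X ^ u ∈ annIdeal s := by
    intro f hf
    obtain ⟨u, hu⟩ := hnonzero _ (aeval_shiftOp_mem_recurrenceSpace hsR f) hf
    refine ⟨u.val, ZMod.val_lt u, ?_⟩
    rw [mem_annIdeal, map_sub, LinearMap.sub_apply, aeval_X_pow_shiftOp, ZMod.natCast_zmod_val, hu,
      sub_self]
  have hperiod : (X ^ (2 ^ m - 1) - 1 : (ZMod 2)[X]) ∈ annIdeal s := by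
    rw [mem_annIdeal, map_sub, LinearMap.sub_apply, aeval_X_pow_shiftOp, ZMod.natCast_self,
      map_one, Module.End.one_apply, sub_eq_zero]
    ext t
    simp [shift]
  have hmax : (annIdeal s).IsMaximal := by
    rw [Ideal.isMaximal_iff]
    constructor
    · rw [mem_annIdeal, map_one]
      exact hs.1
    · intro J f hJ hf hfJ
      obtain ⟨u, hu, hfu⟩ := hpow f hf
      have h1 : X ^ u ∈ J := by
        have := J.sub_mem hfJ (hJ hfu)
        rwa [sub_sub_cancel] at this
      have h3 : (X ^ (2 ^ m - 1) : (ZMod 2)[X]) ∈ J := by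
        rw [← Nat.sub_add_cancel hu.le, pow_add]
        exact J.mul_mem_left _ h1
      have := J.sub_mem h3 (hJ hperiod)
      rwa [sub_sub_cancel] at this
  let L := (ZMod 2)[X] ⧸ annIdeal s
  let : Field L := Ideal.Quotient.field _
  let ev : (ZMod 2)[X] →+ recurrenceSpace (n := 2 ^ m - 1) a :=
    { toFun := fun f => ⟨aeval (shiftOp _) f s, aeval_shiftOp_mem_recurrenceSpace hsR f⟩
      map_zero' := by ext; simp
      map_add' := fun f g => by ext; simp }
  let ev' : L →+ recurrenceSpace (n := 2 ^ m - 1) a :=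
    QuotientAddGroup.lift (annIdeal s).toAddSubgroup ev fun f hf => Subtype.ext hf
  have hev' : ∀ f, ev' (Ideal.Quotient.mk _ f) = ev f := fun f => rfl
  have hevbij : Function.Bijective ev' := by
    constructor
    · rw [injective_iff_map_eq_zero]
      intro x hx
      obtain ⟨f, rfl⟩ := Ideal.Quotient.mk_surjective x
      rw [hev'] at hx
      exact Ideal.Quotient.eq_zero_iff_mem.2 (congrArg Subtype.val hx)
    · intro w
      obtain ⟨x, rfl⟩ := hbij.2 w
      rcases x with _ | u
      · exact ⟨0, map_zero _⟩
      · refine ⟨Ideal.Quotient.mk _ (X ^ u.val), ?_⟩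
        rw [hev']
        ext1
        show aeval (shiftOp _) (X ^ u.val) s = shift u s
        rw [aeval_X_pow_shiftOp, ZMod.natCast_zmod_val]
  have hfin : Finite L := Finite.of_injective ev' hevbij.1
  let : Fintype L := Fintype.ofFinite L
  have hcardL : Fintype.card L = 2 ^ m := by
    rw [← Nat.card_eq_fintype_card, Nat.card_eq_of_bijective _ hevbij,
      ← Nat.card_eq_of_bijective _ hbij, hcard]
  -- Reading a sequence at position `0` is a linear functional on `L`; its representative under the
  -- trace form is `b`.
  let φ₀ : L →+ ZMod 2 :=
    { toFun := fun x => (ev' x).1 0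
      map_zero' := by simp
      map_add' := fun x y => by simp }
  let φ : L →ₗ[ZMod 2] ZMod 2 := φ₀.toZModLinearMap 2
  have hφ : ∀ t : ℕ, φ (Ideal.Quotient.mk (annIdeal s) X ^ t) = s (t : ZMod (2 ^ m - 1)) := by
    intro t
    show (ev (X ^ t)).1 0 = _
    show aeval (shiftOp _) (X ^ t) s 0 = _
    rw [aeval_X_pow_shiftOp, shift, zero_add]
  have hB := traceForm_nondegenerate (ZMod 2) L
  let b : L := ((Algebra.traceForm (ZMod 2) L).toDual hB).symm φ
  have hb : ∀ x, Algebra.trace (ZMod 2) L (b * x) = φ x := fun x =>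
    LinearMap.BilinForm.apply_toDual_symm_apply (hB := hB) (f := φ) (v := x)
  refine ⟨L, inferInstance, inferInstance, inferInstance, Ideal.Quotient.mk _ X, b, hcardL, ?_, ?_, ?_,
    fun t => by rw [hb, hφ]⟩
  · intro hb0
    refine hs.1 (funext fun t => ?_)
    rw [← ZMod.natCast_zmod_val t, ← hφ, ← hb, hb0, zero_mul, map_zero]
    rfl
  · rw [← map_pow, ← map_one (Ideal.Quotient.mk (annIdeal s))]
    exact Ideal.Quotient.eq.2 hperiod
  · intro x hx
    obtain ⟨f, rfl⟩ := Ideal.Quotient.mk_surjective x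
    obtain ⟨u, hu, hfu⟩ := hpow f fun h => hx (Ideal.Quotient.eq_zero_iff_mem.2 h)
    exact ⟨u, hu, by rw [← map_pow]; exact Ideal.Quotient.eq.2 hfu⟩

end GoldType

namespace GoldType

open Module

set_option linter.unusedSectionVars false

/-! ### Gold systems from powers of a generator -/

section Windows

variable {K L : Type*} [Field K] [Field L] [Algebra K L] [FiniteDimensional K L]
variable {ι : Type*} [Fintype ι]

theorem IsGoldSystem.inv {ρ : ι → L ≃ₐ[K] L} (hρ : IsGoldSystem ρ) :
    IsGoldSystem fun j => (ρ j)⁻¹ where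
  injective := inv_injective.comp hρ.injective
  ne_inv i j h := hρ.ne_inv j i (by rw [h, inv_inv])
  thin C hC h := hρ.thin C hC fun g hg => by
    obtain ⟨j, hj⟩ := h g hg
    rw [inv_inv] at hj
    exact ⟨j, hj.symm⟩
  cothin C hC h := hρ.cothin C hC fun g hg => by
    refine ⟨(h g hg).1, fun j => ?_⟩
    have := (h g hg).2 j
    rw [inv_inv] at this
    exact this.symm

/-- Powers of a generator form a Gold system if the exponents and their negatives, as well as the
remaining nonzero exponents, are contained in short cyclic intervals. -/
theorem isGoldSystem_pow [IsGalois K L] {τ : L ≃ₐ[K] L} (hτ : ∀ g, g ∈ Subgroup.zpowers τ)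
    (hord : orderOf τ = finrank K L) {p : ι → ℕ} (hp : ∀ j, p j < finrank K L)
    (hinj : Function.Injective p) (hneg : ∀ i j, p i + p j ≠ finrank K L) (hp0 : ∀ j, 0 < p j)
    (s D : ℕ) (hD : D ≤ 2 * Fintype.card ι) (hDn : D < finrank K L)
    (hthin : ∀ j, (∃ l ≤ D, s + l = p j ∨ s + l = p j + finrank K L) ∧
      ∃ l ≤ D, s + l + p j = finrank K L ∨ s + l + p j = finrank K L + finrank K L)
    (s' D' : ℕ) (hD' : D' + 2 * Fintype.card ι < finrank K L)
    (hcothin : ∀ t < finrank K L, t ≠ 0 → (∀ j, t ≠ p j ∧ t + p j ≠ finrank K L) →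
      ∃ l ≤ D', s' + l = t ∨ s' + l = t + finrank K L) :
    IsGoldSystem fun j => τ ^ p j := by
  classical
  have hfix : ∀ x : L, τ x = x → x ∈ (algebraMap K L).range := fun x =>
    mem_range_algebraMap_of_fixed hτ
  have hone : τ ^ finrank K L = 1 := by rw [← hord, pow_orderOf_eq_one]
  have hpow : ∀ {a b}, a < finrank K L → b < finrank K L → τ ^ a = τ ^ b → a = b := by
    intro a b ha hb
    rw [← hord] at ha hb
    exact fun h => pow_injOn_Iio_orderOf ha hb h
  have hinv : ∀ j, (τ ^ p j)⁻¹ = τ ^ (finrank K L - p j) := by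
    intro j
    rw [inv_eq_iff_mul_eq_one, ← pow_add, Nat.add_sub_cancel' (hp j).le, hone]
  have hwrap : ∀ {a b}, a = b ∨ a = b + finrank K L → τ ^ a = τ ^ b := by
    rintro a b (rfl | rfl)
    · rfl
    · rw [pow_add, hone, mul_one]
  refine ⟨fun i j h => hinj (hpow (hp i) (hp j) h), fun i j h => ?_, fun C hC h => ?_,
    fun C hC h => ?_⟩
  · rw [hinv] at h
    have := hpow (hp i) (by have := hp0 j; omega) h
    have := hp j
    exact hneg i j (by omega)
  · refine (finrank_ker_galOp_le hfix hC (τ ^ s) (hord ▸ hDn) fun g hg => ?_).trans hD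
    obtain ⟨j, rfl | rfl⟩ := h g hg
    · obtain ⟨l, hl, h1⟩ := (hthin j).1
      exact ⟨l, hl, by rw [← pow_add, hwrap h1]⟩
    · obtain ⟨l, hl, h1⟩ := (hthin j).2
      have := hp j
      exact ⟨l, hl, by rw [← pow_add, hinv, hwrap (show s + l = finrank K L - p j ∨ _ by omega)]⟩
  · have h1 := finrank_ker_galOp_le hfix hC (τ ^ s') (D := D') (by omega) fun g hg => ?_
    · omega
    · obtain ⟨t, ht, rfl⟩ := Finset.mem_image.1 (mem_zpowers_iff_mem_range_orderOf.1 (hτ g))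
      rw [Finset.mem_range, hord] at ht
      obtain ⟨hg1, hg2⟩ := h _ hg
      obtain ⟨l, hl, h2⟩ := hcothin t ht (fun h0 => hg1 (by rw [h0, pow_zero])) fun j =>
        ⟨fun h0 => (hg2 j).1 (by rw [h0]), fun h0 => (hg2 j).2 (by
          rw [hinv]
          congr 1
          omega)⟩
      exact ⟨l, hl, by rw [← pow_add, hwrap h2]⟩

/-- The exponents and their negatives lie in `[-κ, κ]`, the others in `[κ + 1, n - κ - 1]`, where `n
= finrank K L`. For `κ = h` the latter is empty and its length parameter truncates to `0`, which is
still admissible. -/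
theorem isGoldSystem_consecutive [IsGalois K L] {τ : L ≃ₐ[K] L}
    (hτ : ∀ g, g ∈ Subgroup.zpowers τ) (hord : orderOf τ = finrank K L) {h κ : ℕ}
    (hn : finrank K L = 2 * h + 1) (hκ : κ ≤ h) :
    IsGoldSystem fun j : Fin κ => τ ^ ((j : ℕ) + 1) := by
  refine isGoldSystem_pow hτ hord (fun j => by omega) (fun i j hij => Fin.ext (by simpa using hij))
    (fun i j => by omega) (fun j => by omega) (finrank K L - κ) (2 * κ) (by simp) (by omega)
    (fun j => ⟨⟨κ + j + 1, by omega, by omega⟩, ⟨κ - j - 1, by omega, by omega⟩⟩) (κ + 1)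
    (finrank K L - 2 * κ - 2) (by rw [Fintype.card_fin]; omega) fun t ht ht0 hj => ?_
  have h1 : κ < t := by
    by_contra! hle
    exact (hj ⟨t - 1, by omega⟩).1 (by simp only; omega)
  have h2 : t + κ < finrank K L := by
    by_contra! hle
    exact (hj ⟨finrank K L - t - 1, by omega⟩).2 (by simp only; omega)
  exact ⟨t - κ - 1, by omega, by omega⟩

/-- The exponents and their negatives fill the middle interval `[h - κ + 1, h + κ]`; the rest lies
in `[-(h - κ), h - κ]`, which may include the exponent `0`. -/
theorem isGoldSystem_descending [IsGalois K L] {τ : L ≃ₐ[K] L}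
    (hτ : ∀ g, g ∈ Subgroup.zpowers τ) (hord : orderOf τ = finrank K L) {h κ : ℕ}
    (hn : finrank K L = 2 * h + 1) (hκ : κ ≤ h) :
    IsGoldSystem fun j : Fin κ => τ ^ (h - (j : ℕ)) := by
  refine isGoldSystem_pow hτ hord (fun j => by omega) (fun i j hij => Fin.ext (by
      have : h - (i : ℕ) = h - j := hij
      omega))
    (fun i j => by omega) (fun j => by omega) (h - κ + 1) (2 * κ - 1) (by simp) (by omega)
    (fun j => ⟨⟨κ - 1 - j, by omega, by omega⟩, ⟨κ + j, by omega, by omega⟩⟩)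
    (finrank K L - (h - κ)) (2 * (h - κ)) (by rw [Fintype.card_fin]; omega) fun t ht ht0 hj => ?_
  have h1 : t ≤ h - κ ∨ h + κ + 1 ≤ t := by
    by_contra! hlt
    rcases le_or_gt t h with hth | hth
    · exact (hj ⟨h - t, by omega⟩).1 (by simp only; omega)
    · exact (hj ⟨t - h - 1, by omega⟩).2 (by simp only; omega)
  rcases h1 with h1 | h1
  · exact ⟨t + (h - κ), by omega, by omega⟩
  · exact ⟨t - (h + 1 + κ), by omega, by omega⟩

end Windows

/-- Artin's theorem for the cyclic group generated by `τ₀`. -/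
theorem exists_generator_over_fixedField {F L : Type*} [Field F] [Field L] [Algebra F L]
    [FiniteDimensional F L] (τ₀ : L ≃ₐ[F] L) :
    ∃ (K : IntermediateField F L) (τ : L ≃ₐ[K] L), (∀ x, τ x = τ₀ x) ∧
      (∀ g, g ∈ Subgroup.zpowers τ) ∧ orderOf τ = orderOf τ₀ ∧ finrank K L = orderOf τ₀ := by
  let H := Subgroup.zpowers τ₀
  let φ := IntermediateField.subgroupEquivAlgEquiv H
  let t : H := ⟨τ₀, Subgroup.mem_zpowers τ₀⟩
  refine ⟨IntermediateField.fixedField H, φ t, fun x => rfl, fun g => ?_, ?_, ?_⟩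
  · obtain ⟨x, rfl⟩ := φ.surjective g
    obtain ⟨z, hz⟩ := Subgroup.mem_zpowers_iff.1 x.2
    exact Subgroup.mem_zpowers_iff.2 ⟨z, by
      rw [← map_zpow]
      congr 1
      exact Subtype.ext hz⟩
  · rw [MulEquiv.orderOf_eq]
    exact Subgroup.orderOf_mk τ₀ _
  · rw [IntermediateField.finrank_fixedField_eq_card, Nat.card_zpowers]

theorem frobenius_pow_apply {L : Type*} [Field L] [Finite L] [Algebra (ZMod 2) L] (c : ℕ) (x : L) :
    (FiniteField.frobeniusAlgEquivOfAlgebraic (ZMod 2) L ^ c) x = x ^ 2 ^ c := by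
  rw [AlgEquiv.coe_pow, FiniteField.coe_frobeniusAlgEquivOfAlgebraic_iterate, ZMod.card]

/-- The automorphisms `x ↦ x ^ (f_j - 1)` form a Gold system over a suitable subfield. -/
theorem Family.exists_isGoldSystem (F : Family) {L : Type*} [Field L] [Finite L]
    [Algebra (ZMod 2) L] {m d e h κ : ℕ} (hL : finrank (ZMod 2) L = m) (he0 : 0 < e)
    (he : e = m.gcd d) (he' : e = m.gcd (2 * d)) (hm : m = e * (2 * h + 1)) (hκ : κ ≤ h) :
    ∃ (K : IntermediateField (ZMod 2) L) (ρ : Fin κ → L ≃ₐ[K] L), IsGoldSystem ρ ∧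
      finrank K L = 2 * h + 1 ∧ ∀ j x, ρ j x = x ^ 2 ^ (F.multiplier m e (j + 1) * d) := by
  have key : ∀ D, e = m.gcd D → ∃ (K : IntermediateField (ZMod 2) L) (τ : L ≃ₐ[K] L),
      (∀ c x, (τ ^ c) x = x ^ 2 ^ (D * c)) ∧ (∀ g, g ∈ Subgroup.zpowers τ) ∧
        orderOf τ = finrank K L ∧ finrank K L = 2 * h + 1 := by
    intro D hD
    obtain ⟨K, τ, h1, h2, h3, h4⟩ := exists_generator_over_fixedField
      (FiniteField.frobeniusAlgEquivOfAlgebraic (ZMod 2) L ^ D)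
    refine ⟨K, τ, fun c x => ?_, h2, by rw [h3, h4], ?_⟩
    · rw [← frobenius_pow_apply, pow_mul]
      induction c with
      | zero => rfl
      | succ c ih => rw [pow_succ', pow_succ', AlgEquiv.mul_apply, AlgEquiv.mul_apply, ih, h1]
    · rw [h4, orderOf_pow, FiniteField.orderOf_frobeniusAlgEquivOfAlgebraic, hL, ← hD, hm,
        Nat.mul_div_cancel_left _ he0]
  cases F with
  | consecutive =>
    obtain ⟨K, τ, h1, h2, h3, h4⟩ := key d he
    refine ⟨K, _, isGoldSystem_consecutive h2 h3 h4 hκ, h4, fun j x => ?_⟩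
    rw [h1, Family.multiplier, mul_comm]
  | descending =>
    obtain ⟨K, τ, h1, h2, h3, h4⟩ := key d he
    refine ⟨K, _, isGoldSystem_descending h2 h3 h4 hκ, h4, fun j x => ?_⟩
    have : (m + e) / (2 * e) = h + 1 := by
      rw [hm, show e * (2 * h + 1) + e = (h + 1) * (2 * e) by ring,
        Nat.mul_div_cancel _ (by omega)]
    rw [h1, Family.multiplier, this, mul_comm, Nat.add_sub_add_right]
  | odd =>
    obtain ⟨K, τ, h1, h2, h3, h4⟩ := key (2 * d) he'
    -- With `τ` the `2d`-th power of Frobenius, inverting `τ ^ (h - j)` gives Frobenius exponent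
    -- `2d(h + 1 + j) = (2h + 1)d + (2j + 1)d`. As `e ∣ d`, the first summand is a multiple of `m`
    -- and acts trivially.
    refine ⟨K, _, (isGoldSystem_descending h2 h3 h4 hκ).inv, h4, fun j x => ?_⟩
    have hinv : (τ ^ (h - (j : ℕ)))⁻¹ = τ ^ (h + 1 + j) := by
      have hj := j.2
      rw [inv_eq_iff_mul_eq_one, ← pow_add, show h - (j : ℕ) + (h + 1 + j) = 2 * h + 1 by omega,
        ← h4, ← h3, pow_orderOf_eq_one]
    obtain ⟨d', hd'⟩ : e ∣ d := he ▸ Nat.gcd_dvd_right m d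
    rw [hinv, h1, Family.multiplier, show 2 * ((j : ℕ) + 1) - 1 = 2 * j + 1 by omega,
      show 2 * d * (h + 1 + j) = m * d' + (2 * j + 1) * d by rw [hm, hd']; ring,
      ← frobenius_pow_apply, pow_add, pow_mul,
      show FiniteField.frobeniusAlgEquivOfAlgebraic (ZMod 2) L ^ m = 1 by
        rw [← hL, ← FiniteField.orderOf_frobeniusAlgEquivOfAlgebraic, pow_orderOf_eq_one],
      one_pow, one_mul, frobenius_pow_apply]

end GoldType

namespace GoldType

open Module

set_option linter.unusedSectionVars false

/-! ### Exponential sums attached to a Gold system -/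

section Quadratic

variable {K L : Type*} [Field K] [Field L] [Algebra K L] [Fintype L] [DecidableEq L]
variable [Algebra (ZMod 2) K] [Algebra (ZMod 2) L] [IsScalarTower (ZMod 2) K L]
variable {ι : Type*} [Fintype ι] {ρ : ι → L ≃ₐ[K] L}

/-- The quadratic function `x ↦ Tr(∑_j a_j x ρ_j(x))`. -/
noncomputable def quadFn (ρ : ι → L ≃ₐ[K] L) (a : ι → L) (x : L) : ZMod 2 :=
  Algebra.trace (ZMod 2) L (∑ j, a j * (x * ρ j x))

theorem quadFn_add (a : ι → L) (x y : L) :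
    quadFn ρ a (x + y) = quadFn ρ a x + quadFn ρ a y +
      Algebra.trace (ZMod 2) L ((polarOp ρ a).toAddMonoidHom x * y) := by
  have h1 : ∀ j, Algebra.trace (ZMod 2) L ((ρ j)⁻¹ (a j * x) * y) =
      Algebra.trace (ZMod 2) L (a j * x * ρ j y) := fun j =>
    trace_inv_apply_mul ((ρ j).restrictScalars (ZMod 2)) (a j * x) y
  have h2 : (polarOp ρ a).toAddMonoidHom x = ∑ j, (a j * ρ j x + (ρ j)⁻¹ (a j * x)) :=
    polarOp_apply ρ a x
  simp only [quadFn, h2, Finset.sum_mul, map_sum, ← Finset.sum_add_distrib]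
  refine Finset.sum_congr rfl fun j _ => ?_
  rw [add_mul (a j * ρ j x), map_add (Algebra.trace (ZMod 2) L) (a j * ρ j x * y), h1, ← map_add,
    ← map_add, ← map_add, map_add (ρ j)]
  congr 1
  ring

variable [FiniteDimensional K L]

theorem natCard_ker_toAddMonoidHom (f : L →ₗ[K] L) :
    Nat.card f.toAddMonoidHom.ker = Nat.card K ^ finrank K (LinearMap.ker f) := by
  rw [← Module.natCard_eq_pow_finrank (K := K) (V := LinearMap.ker f)]
  rfl

/-- The number of pairs of a linear and a quadratic part with given exponential sum, in terms of
the number of quadratic parts with given radical. -/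
theorem two_mul_card_pairs [Finite K] [CharP L 2] {h i : ℕ} (hn : finrank K L = 2 * h + 1)
    (hi : i ≤ h) {ε : ℤ} (hε : ε = 1 ∨ ε = -1) :
    2 * (Nat.card {p : L × (ι → L) //
        expSum (quadFn ρ p.2) p.1 = ε * (Nat.card K : ℤ) ^ (h + 1 + i)} : ℤ) =
      (((Nat.card K : ℤ) ^ (h - i)) ^ 2 + ε * (Nat.card K : ℤ) ^ (h - i)) *
        Nat.card {a : ι → L // finrank K (LinearMap.ker (polarOp ρ a)) = 2 * i + 1} := by
  classical
  have hq1 : 1 < Nat.card K := Finite.one_lt_card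
  have hT : (Nat.card K : ℤ) ^ (h + 1 + i) ≠ 0 := pow_ne_zero _ (by omega)
  have hcard : (Fintype.card L : ℤ) = (Nat.card K : ℤ) ^ (2 * h + 1) := by
    rw [← hn, ← Nat.card_eq_fintype_card, Module.natCard_eq_pow_finrank (K := K) (V := L)]
    push_cast
    rfl
  have hfib : ∀ a : ι → L, 2 * (Nat.card {b : L //
      expSum (quadFn ρ a) b = ε * (Nat.card K : ℤ) ^ (h + 1 + i)} : ℤ) =
      if finrank K (LinearMap.ker (polarOp ρ a)) = 2 * i + 1 then
        ((Nat.card K : ℤ) ^ (h - i)) ^ 2 + ε * (Nat.card K : ℤ) ^ (h - i) else 0 := by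
    intro a
    have hsq : (Fintype.card L : ℤ) * Nat.card (polarOp ρ a).toAddMonoidHom.ker =
        (Nat.card K : ℤ) ^ (2 * h + 1 + finrank K (LinearMap.ker (polarOp ρ a))) := by
      rw [hcard, natCard_ker_toAddMonoidHom, Nat.cast_pow, ← pow_add]
    split_ifs with ha
    -- Here `T = q ^ (h+1+i)` and `t = q ^ (h-i)`, so that `T t = q ^ (2h+1) = |L|`.
    · refine two_mul_card_expSum_eq (quadFn_add a) hT ?_ ?_ hε
      · rw [hcard, ← pow_add]
        congr 1
        omega
      · rw [hsq, ha, ← pow_mul]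
        congr 1
        omega
    · have : IsEmpty {b : L // expSum (quadFn ρ a) b = ε * (Nat.card K : ℤ) ^ (h + 1 + i)} := by
        refine ⟨fun b => expSum_ne_of_sq_ne (quadFn_add a) hT ?_ hε b.1 b.2⟩
        rw [hsq, ← pow_mul]
        intro hE
        have hE' : Nat.card K ^ (2 * h + 1 + finrank K (LinearMap.ker (polarOp ρ a))) =
          Nat.card K ^ ((h + 1 + i) * 2) := by exact_mod_cast hE
        have := Nat.pow_right_injective hq1 hE'
        omega
      simp
  have hsigma : Nat.card {p : L × (ι → L) //
      expSum (quadFn ρ p.2) p.1 = ε * (Nat.card K : ℤ) ^ (h + 1 + i)} =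
      ∑ a : ι → L, Nat.card {b : L //
        expSum (quadFn ρ a) b = ε * (Nat.card K : ℤ) ^ (h + 1 + i)} := by
    rw [← Nat.card_sigma]
    exact Nat.card_congr
      { toFun := fun p => ⟨p.1.2, p.1.1, p.2⟩
        invFun := fun p => ⟨(p.2.1, p.1), p.2.2⟩
        left_inv := fun _ => rfl
        right_inv := fun _ => rfl }
  rw [hsigma, Nat.cast_sum, Finset.mul_sum, Finset.sum_congr rfl fun a _ => hfib a,
    ← Finset.sum_filter, Finset.sum_const, nsmul_eq_mul, mul_comm,
    Nat.card_eq_fintype_card (α := {a : ι → L // _}), Fintype.card_subtype]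

/-- By multiplicativity consider `z * g z = 1`: then `g` inverts `z` and `g ^ 2` fixes it, so odd
order forces `g z = z`, hence `z ^ 2 = 1` and `z = 1`. Thus the decimation factors are prime to `2 ^
m - 1`. -/
theorem mul_apply_injective [CharP L 2] (g : L ≃ₐ[K] L) {h : ℕ} (hg : g ^ (2 * h + 1) = 1) :
    Function.Injective fun x : L => x * g x := by
  have hone : ∀ z : L, z * g z = 1 → z = 1 := by
    intro z hz
    have hz0 : z ≠ 0 := left_ne_zero_of_mul_eq_one hz
    have h1 : g z = z⁻¹ := eq_inv_of_mul_eq_one_right hz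
    have h2 : ∀ l, (g ^ (2 * l)) z = z := by
      intro l
      induction l with
      | zero => rfl
      | succ l ih =>
        rw [show 2 * (l + 1) = 2 * l + 1 + 1 by ring, pow_succ, pow_succ, AlgEquiv.mul_apply,
          AlgEquiv.mul_apply, h1, map_inv₀, h1, inv_inv, ih]
    have h3 : g z = z := by
      conv_rhs => rw [← AlgEquiv.one_apply (R := K) z, ← hg, pow_succ', AlgEquiv.mul_apply, h2 h]
    rw [h3] at hz
    have : (z + 1) * (z + 1) = 0 := by
      rw [CharTwo.add_mul_self, hz, one_mul]
      exact CharTwo.add_self_eq_zero 1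
    exact CharTwo.add_eq_zero.1 (mul_self_eq_zero.1 this)
  intro x y hxy
  simp only at hxy
  by_cases hy : y = 0
  · rw [hy, zero_mul, mul_eq_zero, map_eq_zero_iff _ g.injective, or_self] at hxy
    rw [hxy, hy]
  · have hgy : g y ≠ 0 := (map_ne_zero_iff _ g.injective).2 hy
    have := hone (x / y) (by rw [map_div₀, div_mul_div_comm, hxy, div_self (mul_ne_zero hy hgy)])
    rwa [div_eq_one_iff_eq hy] at this

end Quadratic

/-! ### Parametrisation of the code -/

section Words

variable {K L : Type*} [Field K] [Field L] [Algebra K L] [Fintype L] [DecidableEq L]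
variable [Algebra (ZMod 2) K] [Algebra (ZMod 2) L] [IsScalarTower (ZMod 2) K L]
variable {ι : Type*} [Fintype ι] {ρ : ι → L ≃ₐ[K] L}

/-- The sequence `t ↦ Tr(a₀ γ ^ t + ∑_j a_j γ ^ t ρ_j(γ ^ t))`. -/
noncomputable def word (n : ℕ) (ρ : ι → L ≃ₐ[K] L) (γ : L) :
    L × (ι → L) →ₗ[ZMod 2] BinSeq n where
  toFun p t := quadFn ρ p.2 (γ ^ t.val) + Algebra.trace (ZMod 2) L (p.1 * γ ^ t.val)
  map_add' p p' := by
    ext t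
    simp only [quadFn, Pi.add_apply, Prod.fst_add, Prod.snd_add, add_mul, map_add,
      Finset.sum_add_distrib]
    ring
  map_smul' c p := by
    ext t
    simp only [quadFn, Pi.smul_apply, Prod.smul_fst, Prod.smul_snd, smul_mul_assoc,
      ← Finset.smul_sum, map_smul, RingHom.id_apply, smul_add]

theorem word_apply (n : ℕ) (ρ : ι → L ≃ₐ[K] L) (γ : L) (p : L × (ι → L)) (t : ZMod n) :
    word n ρ γ p t =
      quadFn ρ p.2 (γ ^ t.val) + Algebra.trace (ZMod 2) L (p.1 * γ ^ t.val) := rfl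

variable {n : ℕ} {γ : L}

theorem pow_val_natCast (hγ : γ ^ n = 1) (t : ℕ) : γ ^ (t : ZMod n).val = γ ^ t := by
  rw [ZMod.val_natCast, ← pow_eq_pow_mod t hγ]

theorem quadFn_zero_right (a : ι → L) : quadFn ρ a 0 = 0 := by
  simp [quadFn]

theorem sum_range_pow (hn : Fintype.card L = n + 1) (hγ : γ ^ n = 1)
    (hprim : ∀ x : L, x ≠ 0 → ∃ u < n, x = γ ^ u) (G : L → ℤ) :
    ∑ t ∈ Finset.range n, G (γ ^ t) = ∑ x, G x - G 0 := by
  have hn0 : n ≠ 0 := by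
    have := Fintype.one_lt_card (α := L)
    omega
  have hγ0 : γ ≠ 0 := by
    rintro rfl
    rw [zero_pow hn0] at hγ
    exact zero_ne_one hγ
  have himg : (Finset.range n).image (fun t => γ ^ t) = Finset.univ.erase 0 := by
    ext x
    simp only [Finset.mem_image, Finset.mem_range, Finset.mem_erase, Finset.mem_univ, and_true]
    constructor
    · rintro ⟨t, -, rfl⟩
      exact pow_ne_zero _ hγ0
    · intro hx
      obtain ⟨u, hu, rfl⟩ := hprim x hx
      exact ⟨u, hu, rfl⟩
  have hinj : Set.InjOn (fun t => γ ^ t) (Finset.range n : Set ℕ) := by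
    rw [← Finset.card_image_iff, himg, Finset.card_erase_of_mem (Finset.mem_univ _),
      Finset.card_univ, hn, Finset.card_range, Nat.add_sub_cancel]
  rw [← Finset.sum_image (f := G) hinj, himg, ← Finset.add_sum_erase _ G (Finset.mem_univ 0)]
  ring

/-- The powers of `γ` miss only `x = 0`, whose term is `1`; hence the `-1`. -/
theorem DC_word (hn : Fintype.card L = n + 1) (hγ : γ ^ n = 1)
    (hprim : ∀ x : L, x ≠ 0 → ∃ u < n, x = γ ^ u) (p : L × (ι → L)) :
    DC (word n ρ γ p) = -1 + expSum (quadFn ρ p.2) p.1 := by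
  have h1 : DC (word n ρ γ p) = ∑ t ∈ Finset.range n,
      sgn (quadFn ρ p.2 (γ ^ t) + Algebra.trace (ZMod 2) L (p.1 * γ ^ t)) := by
    refine Finset.sum_congr rfl fun t _ => ?_
    rw [word_apply, pow_val_natCast hγ]
    rfl
  rw [h1, sum_range_pow hn hγ hprim
    (fun x => sgn (quadFn ρ p.2 x + Algebra.trace (ZMod 2) L (p.1 * x)))]
  simp only [quadFn_zero_right, mul_zero, map_zero, add_zero, sgn_zero, expSum]
  ring

variable [FiniteDimensional K L]

/-- A zero word makes the quadratic function vanish on `L`, hence also its polar form; `thin` and `2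
* card ι < finrank K L` then force `a = 0`. -/
theorem word_injective [NeZero n] (hρ : IsGoldSystem ρ)
    (hdim : 2 * Fintype.card ι < finrank K L) (hγ : γ ^ n = 1)
    (hprim : ∀ x : L, x ≠ 0 → ∃ u < n, x = γ ^ u) : Function.Injective (word n ρ γ) := by
  rw [injective_iff_map_eq_zero]
  rintro ⟨b, a⟩ hp
  have h0 : ∀ x : L, quadFn ρ a x + Algebra.trace (ZMod 2) L (b * x) = 0 := by
    intro x
    by_cases hx : x = 0
    · simp [hx, quadFn_zero_right]
    · obtain ⟨u, -, rfl⟩ := hprim x hx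
      have := congrFun hp (u : ZMod n)
      rwa [word_apply, pow_val_natCast hγ] at this
  have ha : a = 0 := by
    by_contra ha
    have hker : LinearMap.ker (polarOp ρ a) = ⊤ := by
      rw [eq_top_iff]
      intro x _
      rw [LinearMap.mem_ker]
      refine eq_zero_of_trace_mul_eq_zero (K := ZMod 2) fun y => ?_
      have h1 := h0 (x + y)
      rw [quadFn_add, mul_add, map_add] at h1
      have h2 := h0 x
      have h3 := h0 y
      have h4 : Algebra.trace (ZMod 2) L ((polarOp ρ a).toAddMonoidHom x * y) = 0 := by
        linear_combination h1 - h2 - h3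
      exact h4
    have := hρ.finrank_ker_polarOp_le ha
    rw [hker, finrank_top] at this
    omega
  have hb : b = 0 := by
    refine eq_zero_of_trace_mul_eq_zero (K := ZMod 2) fun x => ?_
    have := h0 x
    rw [ha] at this
    simpa [quadFn] using this
  rw [ha, hb]
  rfl

theorem code_eq_range_word {m d e k : ℕ} {F : Family} {ρ : Fin (k - 1) → L ≃ₐ[K] L} [CharP L 2]
    [NeZero (2 ^ m - 1)] {h : ℕ} (hodd : ∀ j, ρ j ^ (2 * h + 1) = 1)
    (hfac : ∀ j x, ρ j x = x ^ 2 ^ (F.multiplier m e (j + 1) * d))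
    (hprim : ∀ x : L, x ≠ 0 → ∃ u < 2 ^ m - 1, x = γ ^ u) {b : L}
    (hb : b ≠ 0) {s : BinSeq (2 ^ m - 1)}
    (hs : ∀ t : ℕ, s (t : ZMod (2 ^ m - 1)) = Algebra.trace (ZMod 2) L (b * γ ^ t)) :
    code F m d e k s = LinearMap.range (word (2 ^ m - 1) ρ γ) := by
  classical
  have hpow : ∀ j x, x * ρ j x = x ^ F.factor m d e (j + 1) := by
    intro j x
    rw [hfac, Family.factor, pow_succ']
  have hlin : ∀ u : ℕ, shift (u : ZMod (2 ^ m - 1)) s = word _ ρ γ (b * γ ^ u, 0) := by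
    intro u
    ext t
    rw [word_apply, shift]
    conv_lhs => rw [← ZMod.natCast_zmod_val t, ← Nat.cast_add, hs]
    simp [quadFn, pow_add, mul_assoc, mul_comm (γ ^ u)]
  have hquad : ∀ (j : Fin (k - 1)) (u : ℕ),
      shift (u : ZMod (2 ^ m - 1)) (decimate (F.factor m d e (j + 1)) s) =
        word _ ρ γ (0, Pi.single j (b * γ ^ (F.factor m d e (j + 1) * u))) := by
    intro j u
    ext t
    rw [word_apply, shift, decimate]
    conv_lhs => rw [← ZMod.natCast_zmod_val t, ← Nat.cast_add, ← Nat.cast_mul, hs]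
    rw [zero_mul, map_zero, add_zero, quadFn,
      Finset.sum_eq_single j (fun i _ hi => by simp [hi]) (by simp)]
    dsimp only
    rw [Pi.single_eq_same, hpow]
    congr 1
    ring
  apply le_antisymm
  · refine Submodule.span_le.2 ?_
    rintro c ⟨u, hu⟩
    rw [← ZMod.natCast_zmod_val u] at hu
    rcases hu with rfl | ⟨j, hj, rfl⟩
    · rw [hlin]
      exact ⟨_, rfl⟩
    · obtain ⟨h1, h2⟩ := Finset.mem_Icc.1 hj
      have := hquad ⟨j - 1, by omega⟩ u.val
      simp only [Nat.sub_add_cancel h1] at this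
      rw [this]
      exact ⟨_, rfl⟩
  · rintro _ ⟨⟨a₀, a⟩, rfl⟩
    have hdecomp : (a₀, a) = (a₀, (0 : Fin (k - 1) → L)) + ∑ j, ((0 : L), Pi.single j (a j)) := by
      ext x
      · simp [Prod.fst_sum]
      · simp [Prod.snd_sum, Finset.univ_sum_single]
    rw [hdecomp, map_add, map_sum]
    refine Submodule.add_mem _ ?_ (Submodule.sum_mem _ fun j _ => ?_)
    · by_cases ha : a₀ = 0
      · rw [ha]
        exact (map_zero (word (2 ^ m - 1) ρ γ)).symm ▸ Submodule.zero_mem _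
      · obtain ⟨u, -, hu⟩ := hprim (a₀ / b) (div_ne_zero ha hb)
        have : a₀ = b * γ ^ u := by rw [← hu, mul_div_cancel₀ _ hb]
        rw [this, ← hlin]
        exact Submodule.subset_span ⟨_, Or.inl rfl⟩
    · by_cases ha : a j = 0
      · rw [ha, Pi.single_zero]
        exact (map_zero (word (2 ^ m - 1) ρ γ)).symm ▸ Submodule.zero_mem _
      -- Since `y ↦ y * ρ_j y` permutes `L`, every nonzero coefficient `a j` arises from a single
      -- shift of the decimated sequence.
      · obtain ⟨y, hy⟩ := Finite.surjective_of_injective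
          (mul_apply_injective (ρ j) (hodd j)) (a j / b)
        simp only [hpow] at hy
        have hy0 : y ≠ 0 := by
          rintro rfl
          rw [zero_pow (by simp [Family.factor])] at hy
          exact div_ne_zero ha hb hy.symm
        obtain ⟨u, -, rfl⟩ := hprim y hy0
        have : a j = b * γ ^ (F.factor m d e (j + 1) * u) := by
          rw [mul_comm (F.factor m d e (j + 1)), pow_mul, hy, mul_div_cancel₀ _ hb]
        rw [this, ← hquad]
        exact Submodule.subset_span
          ⟨_, Or.inr ⟨j + 1, Finset.mem_Icc.2 ⟨by omega, by omega⟩, rfl⟩⟩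

end Words

end GoldType

namespace GoldType

open Module

/-! ### The weight distribution -/

theorem exists_eq_mul_two_mul_add_one {m d e : ℕ} (hm : 0 < m) (he : e = m.gcd d)
    (he' : e = m.gcd (2 * d)) : 0 < e ∧ ∃ h, m = e * (2 * h + 1) := by
  have he0 : 0 < e := he ▸ Nat.gcd_pos_of_pos_left d hm
  obtain ⟨m', hm'⟩ : e ∣ m := he ▸ Nat.gcd_dvd_left m d
  obtain ⟨d', hd'⟩ : e ∣ d := he ▸ Nat.gcd_dvd_right m d
  refine ⟨he0, ?_⟩
  have h1 : m'.gcd (2 * d') = 1 := by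
    rw [hm', hd', show 2 * (e * d') = e * (2 * d') by ring, Nat.gcd_mul_left] at he'
    exact Nat.eq_of_mul_eq_mul_left he0 (by rw [mul_one]; exact he'.symm)
  have h2 : ¬ 2 ∣ m' := fun h => by
    have := Nat.dvd_gcd h (dvd_mul_right 2 d')
    rw [h1] at this
    omega
  exact ⟨m' / 2, by rw [hm']; congr 1; omega⟩

/-- The condition `c ≠ 0` costs nothing: the zero word has exponential sum `2 ^ m`, larger than `2 ^
(m - e * r / 2)`. -/
theorem dcFrequency_range_word {K L : Type*} [Field K] [Field L] [Algebra K L] [Fintype L]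
    [DecidableEq L] [Algebra (ZMod 2) K] [Algebra (ZMod 2) L] [IsScalarTower (ZMod 2) K L]
    [FiniteDimensional K L] {ι : Type*} [Fintype ι] {ρ : ι → L ≃ₐ[K] L} {γ : L} {m e r : ℕ}
    [NeZero (2 ^ m - 1)] (hρ : IsGoldSystem ρ) (hdim : 2 * Fintype.card ι < finrank K L)
    (hcard : Fintype.card L = 2 ^ m) (hγ : γ ^ (2 ^ m - 1) = 1)
    (hprim : ∀ x : L, x ≠ 0 → ∃ u < 2 ^ m - 1, x = γ ^ u) (hr : m - e * r / 2 < m) {ε : ℤ}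
    (hε : ε = 1 ∨ ε = -1) :
    dcFrequency m e (LinearMap.range (word (2 ^ m - 1) ρ γ)) r ε =
      Nat.card {p : L × (ι → L) // expSum (quadFn ρ p.2) p.1 = ε * 2 ^ (m - e * r / 2)} := by
  have hn : Fintype.card L = 2 ^ m - 1 + 1 := by
    have := Nat.one_le_two_pow (n := m)
    omega
  have hset : {c : BinSeq (2 ^ m - 1) | c ∈ LinearMap.range (word (2 ^ m - 1) ρ γ) ∧ c ≠ 0 ∧
      DC c = -1 + ε * 2 ^ (m - e * r / 2)} = word (2 ^ m - 1) ρ γ ''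
        {p | expSum (quadFn ρ p.2) p.1 = ε * 2 ^ (m - e * r / 2)} := by
    ext c
    constructor
    · rintro ⟨⟨p, rfl⟩, -, hDC⟩
      rw [DC_word hn hγ hprim] at hDC
      exact ⟨p, add_left_cancel hDC, rfl⟩
    · rintro ⟨p, hp, rfl⟩
      refine ⟨⟨p, rfl⟩, fun h0 => ?_, by rw [DC_word hn hγ hprim, hp]⟩
      obtain rfl := (map_eq_zero_iff _ (word_injective hρ hdim hγ hprim)).1 h0
      have h1 : expSum (quadFn ρ (0 : ι → L)) (0 : L) = 2 ^ m := by
        simp [expSum, quadFn, hcard]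
      have h2 : (2 : ℤ) ^ m = ε * 2 ^ (m - e * r / 2) := h1.symm.trans hp
      have h3 : (2 : ℤ) ^ (m - e * r / 2) < 2 ^ m := pow_lt_pow_right₀ one_lt_two hr
      have h4 : (0 : ℤ) < 2 ^ (m - e * r / 2) := by positivity
      rcases hε with rfl | rfl <;> linarith
  rw [dcFrequency, hset, Set.ncard_image_of_injective _ (word_injective hρ hdim hγ hprim)]
  rfl

end GoldType

/-! ### Assembly of the frequency formula -/

theorem theorem1p2 (m d e k : ℕ) (hm : 0 < m) (hd : 0 < d)
    (he : e = Nat.gcd m d) (he' : e = Nat.gcd m (2 * d))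
    (hk : 2 ≤ k) (hk' : k ≤ (m + e) / (2 * e))
    (s : GoldType.BinSeq (2 ^ m - 1)) (hs : GoldType.IsMaximumLength m s)
    (F : GoldType.Family) (i : ℕ) (hi : i ≤ k - 2) (ε : ℤ) (hε : ε = 1 ∨ ε = -1) :
    (GoldType.dcFrequency m e (GoldType.code F m d e k s) ((m - e) / e - 2 * i) ε : ℚ) =
      1 / 2 * (2 ^ (m - e - 2 * e * i) + (ε : ℚ) * 2 ^ ((m - e) / 2 - e * i)) *
        ∑ j ∈ Finset.Icc i (k - 2),
          (-1) ^ (j - i) * 4 ^ (e * Nat.choose (j - i) 2) *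
            GoldType.gaussBinom (4 ^ e) j i *
            GoldType.gaussBinom (4 ^ e) ((m - e) / (2 * e)) j *
            (2 ^ (m * (k - 1 - j)) - 1) := by
  classical
  obtain ⟨he0, h, hmh⟩ := GoldType.exists_eq_mul_two_mul_add_one hm he he'
  have hme : m - e = e * (2 * h) := by rw [hmh, mul_add, mul_one, Nat.add_sub_cancel]
  have e1 : (m + e) / (2 * e) = h + 1 := by
    rw [hmh, show e * (2 * h + 1) + e = (h + 1) * (2 * e) by ring, Nat.mul_div_cancel _ (by omega)]
  have e2 : (m - e) / e = 2 * h := by rw [hme, Nat.mul_div_cancel_left _ he0]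
  have e3 : (m - e) / (2 * e) = h := by
    rw [hme, show e * (2 * h) = h * (2 * e) by ring, Nat.mul_div_cancel _ (by omega)]
  have e4 : (m - e) / 2 - e * i = e * (h - i) := by
    rw [hme, show e * (2 * h) = 2 * (e * h) by ring, Nat.mul_div_cancel_left _ two_pos,
      Nat.mul_sub]
  have e5 : m - e - 2 * e * i = e * (h - i) * 2 := by
    rw [hme, show e * (2 * h) = 2 * e * h by ring, ← Nat.mul_sub]
    ring
  have e6 : e * ((m - e) / e - 2 * i) / 2 = e * (h - i) := by
    rw [e2, ← Nat.mul_sub, show e * (2 * (h - i)) = 2 * (e * (h - i)) by ring,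
      Nat.mul_div_cancel_left _ two_pos]
  rw [e1] at hk'
  -- Thus the prescribed DC value is `-1 + ε * |K| ^ (h+1+i)`, matching a kernel of dimension `2i +
  -- 1`.
  have e7 : m - e * ((m - e) / e - 2 * i) / 2 = e * (h + 1 + i) := by
    rw [e6, hmh, ← Nat.mul_sub]
    congr 1
    omega
  obtain ⟨L, _, _, _, γ, b, hcard, hb, hγ, hprim, hsγ⟩ := hs.exists_field hm
  have hL : Module.finrank (ZMod 2) L = m := by
    have h1 := Module.card_eq_pow_finrank (K := ZMod 2) (V := L)
    rw [hcard, ZMod.card] at h1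
    exact (Nat.pow_right_injective le_rfl h1).symm
  have : CharP L 2 := charP_of_injective_algebraMap (algebraMap (ZMod 2) L).injective 2
  have : NeZero (2 ^ m - 1) := ⟨by
    have := le_self_pow₀ (one_le_two (α := ℕ)) hm.ne'
    omega⟩
  obtain ⟨K, ρ, hρ, hn, hfac⟩ :=
    F.exists_isGoldSystem (κ := k - 1) hL he0 he he' hmh (by omega)
  have hodd : ∀ j, ρ j ^ (2 * h + 1) = 1 := fun j => by
    rw [← hn, ← IsGalois.card_aut_eq_finrank, pow_card_eq_one']
  have hK : Nat.card K = 2 ^ e := by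
    have h1 := Module.natCard_eq_pow_finrank (K := K) (V := L)
    rw [Nat.card_eq_fintype_card, hcard, hn, hmh, pow_mul] at h1
    exact (Nat.pow_left_injective (Nat.succ_ne_zero (2 * h)) h1).symm
  have hlt : e * (h + 1 + i) < m := by
    rw [hmh]
    exact Nat.mul_lt_mul_of_pos_left (by omega) he0
  have hfreq := GoldType.dcFrequency_range_word (e := e) (r := (m - e) / e - 2 * i) hρ
    (by rw [Fintype.card_fin, hn]; omega) hcard hγ hprim (by rw [e7]; exact hlt) hε
  have hpairs := GoldType.two_mul_card_pairs (ρ := ρ) hn (show i ≤ h by omega) hε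
  have hdist := hρ.card_finrank_ker_eq hn (by rw [Fintype.card_fin]; omega)
    (by rw [Fintype.card_fin]; omega) (show i ≤ _ by rw [Fintype.card_fin]; omega)
  rw [e7] at hfreq
  rw [hK, Nat.cast_pow, Nat.cast_ofNat, ← pow_mul 2 e (h + 1 + i), ← pow_mul 2 e (h - i),
    ← hfreq] at hpairs
  rw [GoldType.code_eq_range_word hodd hfac hprim hb hsγ]
  have hpairs' : 2 * (GoldType.dcFrequency m e
      (LinearMap.range (GoldType.word (2 ^ m - 1) ρ γ)) ((m - e) / e - 2 * i) ε : ℚ) =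
      ((2 ^ (e * (h - i))) ^ 2 + ε * 2 ^ (e * (h - i))) *
        (Nat.card {a : Fin (k - 1) → L //
          Module.finrank K (LinearMap.ker (GoldType.polarOp ρ a)) = 2 * i + 1} : ℚ) := by
    exact_mod_cast hpairs
  have hsum : ∑ j ∈ Finset.Icc i (k - 2),
      (-1 : ℚ) ^ (j - i) * 4 ^ (e * Nat.choose (j - i) 2) * GoldType.gaussBinom (4 ^ e) j i *
        GoldType.gaussBinom (4 ^ e) ((m - e) / (2 * e)) j * (2 ^ (m * (k - 1 - j)) - 1) =
      (Nat.card {a : Fin (k - 1) → L //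
          Module.finrank K (LinearMap.ker (GoldType.polarOp ρ a)) = 2 * i + 1} : ℚ) := by
    rw [hdist, hK, Fintype.card_fin, hn, e3, show k - 1 - 1 = k - 2 by omega]
    refine Finset.sum_congr rfl fun j _ => ?_
    have h4 : ((2 ^ e : ℕ) : ℚ) ^ 2 = 4 ^ e := by
      push_cast
      rw [← pow_mul, mul_comm, pow_mul]
      norm_num
    rw [h4, ← pow_mul, Nat.cast_pow, Nat.cast_ofNat, ← pow_mul, ← mul_assoc e, ← hmh]
    ring
  rw [hsum, e4, e5, pow_mul (2 : ℚ) (e * (h - i)) 2]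
  linear_combination (1 / 2 : ℚ) * hpairs'
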